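/- **Market model.** In round $t=1,\dots,T$ a feature $x_t\in[0,1]^d$ is drawn i.i.d. from a law $P_X$. The supply curve is $P_{St}(Q)=\alpha_0+\alpha_1Q+\epsilon_{St}$ and the demand curve is $P_{Dt}(Q,x_t)=\beta Q+f(x_t)+\epsilon_{Dt}$, with $\alpha_1\ge 0>\beta$. The $\epsilon_{St}$ are i.i.d., zero-mean and sub-Gaussian with variance $\sigma_S^2$; the $\epsilon_{Dt}$ are i.i.d., zero-mean and strongly log-concave with variance $\sigma_D^2$; features and noises are independent. The platform sees $x_t$ and the supply intercept $\alpha_0+\epsilon_{St}$ and chooses a fee $a_t$ as a (measurable, possibly randomized) function of these and of the past observations $(\alpha_0+\epsilon_{S\tau},x_\tau,P^e_\tau,Q^e_\tau)_{\tau<t}$. The buyer reports a demand curve $P'_{Dt}=P_{Dt}+\xi_t$, and the equilibrium $(P^e_t,Q^e_t)$ solves $P^e_t=P_{St}(Q^e_t)+a_t=P'_{Dt}(Q^e_t,x_t)$ (no truncation). The buyer is called myopic (discount rate $\gamma=0$) if each report maximizes the surplus of the current round, $\int_0^{Q^e_t}\big(P_{Dt}(Q,x_t)-P_{St}(Q)-a_t\big)\,dQ$.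 With $Q^e(P_S,P_D,a)$ the equilibrium quantity, and with $a_t^*$ the fee $a\ge 0$ that maximizes the expectation over $\epsilon_{Dt}$ of $a\,Q^e(P_{St},P_{Dt},a)$, the expected regret is $$\mathrm{Regret}(T)=\sum_{t=1}^T\mathbb E\big[a_t^*\,Q^e(P_{St},P_{Dt},a_t^*)-a_t\,Q^e(P_{St},P'_{Dt},a_t)\big]\in[-\infty,\infty].$$ **Theorem.** Suppose that the supply has no noise, i.e. $\sigma_S^2=0$. Fix $\alpha_1\ge0$, $B>0$, $\alpha_0<B$, $\underline\beta<\overline\beta<0$ and $0\le \underline v<\overline v$. There is a constant $c>0$, depending only on these seven numbers, such that the following holds for every $d$, every law $P_X$ on $[0,1]^d$, every class $\mathcal F$ of functions on $\mathbb R^d$ that contains the constants with values in $[-B,B]$, every $T\ge1$ and every algorithm (which may depend on all of the above, in particular on $T$): there is a market as above, with supply intercept $\alpha_0$, supply slope $\alpha_1$, feature law $P_X$, $\sigma_S^2=0$, $f\in\mathcal F$, $|f|\le B$, $\beta\in[\underline\beta,\overline\beta]$ and $\sigma_D^2\in[\underline v,\overline v]$, in which the expected regret of the algorithm against every myopic buyer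 satisfies $$\mathrm{Regret}(T)\ \ge\ c\,\sqrt T .$$ That is, the worst-case expected regret of any algorithm is $\Omega(\sqrt T)$. -/

import Mathlib

open MeasureTheory ProbabilityTheory

noncomputable section

namespace ServiceFee

/-- A law on `ℝ` is strongly log-concave: on a convex set it has a density `exp (-φ)`
with `φ` strongly convex, and it gives no mass to the complement of that set. -/
def StronglyLogConcave (ν : Measure ℝ) : Prop :=
  ∃ (S : Set ℝ) (κ : ℝ) (φ : ℝ → ℝ), Convex ℝ S ∧ 0 < κ ∧ StrongConvexOn S κ φ ∧
    ν = (volume.restrict S).withDensity (fun e => ENNReal.ofReal (Real.exp (-φ e)))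

/-- A market with supply curve `P = α₀ + α₁ Q + ε_S` and demand curve
`P = β Q + f x + ε_D`, where in every round the feature `x` and the two noises are drawn
independently from the three laws below. -/
structure Market (d : ℕ) where
  α₀ : ℝ
  α₁ : ℝ
  β : ℝ
  f : (Fin d → ℝ) → ℝ
  featureLaw : Measure (Fin d → ℝ)
  supplyNoise : Measure ℝ
  demandNoise : Measure ℝ
  α₁_nonneg : 0 ≤ α₁
  β_neg : β < 0
  measurable_f : Measurable f
  isProb_feature : IsProbabilityMeasure featureLaw
  isProb_supply : IsProbabilityMeasure supplyNoise
  isProb_demand : IsProbabilityMeasure demandNoise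
  feature_mem : ∀ᵐ x ∂featureLaw, x ∈ Set.Icc (0 : Fin d → ℝ) 1
  supply_mean : ∫ e, e ∂supplyNoise = 0
  supply_subGaussian : ∃ η : NNReal, HasSubgaussianMGF (fun e : ℝ => e) η supplyNoise
  demand_memLp : MemLp (fun e : ℝ => e) 2 demandNoise
  demand_mean : ∫ e, e ∂demandNoise = 0
  demand_logConcave : StronglyLogConcave demandNoise

/-- What the platform sees after a round: the intercept `α₀ + ε_S` of the supply curve,
the feature, the equilibrium price and the equilibrium quantity. -/
abbrev Obs (d : ℕ) : Type := ℝ × (Fin d → ℝ) × ℝ × ℝ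

/-- The primitive randomness of a round: the feature, `ε_S` and `ε_D`. -/
abbrev Shock (d : ℕ) : Type := (Fin d → ℝ) × ℝ × ℝ

/-- A possibly randomized algorithm of the platform. All its internal randomness is a seed,
drawn once and independently of the market; the fee of round `t` is a measurable function of
the seed, the observations of the earlier rounds, the current feature and the current supply
intercept. Fees of either sign are allowed. -/
structure Policy (d : ℕ) where
  Seed : Type*
  [instSeed : MeasurableSpace Seed]
  seedLaw : Measure Seed
  isProb_seed : IsProbabilityMeasure seedLaw
  fee : (t : ℕ) → Seed → (Fin t → Obs d) → (Fin d → ℝ) → ℝ → ℝ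
  measurable_fee : ∀ t, Measurable
    (fun p : Seed × (Fin t → Obs d) × (Fin d → ℝ) × ℝ => fee t p.1 p.2.1 p.2.2.1 p.2.2.2)

attribute [instance] Policy.instSeed

/-- A reporting rule of the buyer: in round `t`, knowing the past observations, the feature,
the supply intercept, the fee and the own noise `ε_D` (in this order), the buyer shifts the
demand curve by the returned number `ξ`, that is, reports `P = β Q + f x + ε_D + ξ`. -/
abbrev Buyer (d : ℕ) : Type :=
  (t : ℕ) → (Fin t → Obs d) → (Fin d → ℝ) → ℝ → ℝ → ℝ → ℝ

/-- Expectation, with values in the extended reals, of a real random variable. It is `⊥` when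
both the positive and the negative part have infinite expectation. -/
def extExpect {Ω : Type*} [MeasurableSpace Ω] (μ : Measure Ω) (g : Ω → ℝ) : EReal :=
  ((∫⁻ w, ENNReal.ofReal (g w) ∂μ : ENNReal) : EReal) -
    ((∫⁻ w, ENNReal.ofReal (-g w) ∂μ : ENNReal) : EReal)

namespace Market

variable {d : ℕ} (M : Market d)

/-- The equilibrium quantity with supply intercept `s`, feature `x`, fee `a`, demand noise `e`
and reported shift `ξ`. -/
def quantity (s : ℝ) (x : Fin d → ℝ) (a e ξ : ℝ) : ℝ :=
  (M.f x + e + ξ - s - a) / (M.α₁ - M.β)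

/-- The equilibrium price (paid by the buyer, fee included). -/
def price (s : ℝ) (x : Fin d → ℝ) (a e ξ : ℝ) : ℝ :=
  s + M.α₁ * M.quantity s x a e ξ + a

/-- `quantity` is the solution of `P_S(Q) + a = P'_D(Q, x)`. -/
theorem equilibrium (s : ℝ) (x : Fin d → ℝ) (a e ξ q : ℝ) :
    s + M.α₁ * q + a = M.β * q + M.f x + e + ξ ↔ q = M.quantity s x a e ξ := by
  have h : M.α₁ - M.β ≠ 0 := by have := M.α₁_nonneg; have := M.β_neg; linarith
  unfold quantity
  rw [eq_div_iff h]
  constructor <;> intro h' <;> linarith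

/-- The buyer's surplus in a round in which the quantity `q` is traded:
`∫₀^q (P_D(Q, x) - P_S(Q) - a) dQ` with the true demand curve. -/
def surplus (s : ℝ) (x : Fin d → ℝ) (a e q : ℝ) : ℝ :=
  ∫ y in (0 : ℝ)..q, ((M.β * y + M.f x + e) - (s + M.α₁ * y) - a)

/-- A myopic buyer, that is, one with discount rate `0`: the discounted sum of the current and
future surpluses is the surplus of the current round, and every report maximizes it. -/
def IsMyopic (b : Buyer d) : Prop :=
  ∀ (t : ℕ) (h : Fin t → Obs d) (x : Fin d → ℝ) (s a e ξ : ℝ),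
    M.surplus s x a e (M.quantity s x a e ξ) ≤
      M.surplus s x a e (M.quantity s x a e (b t h x s a e))

theorem surplus_eq (s : ℝ) (x : Fin d → ℝ) (a e q : ℝ) :
    M.surplus s x a e q = (M.f x + e - s - a) * q - (M.α₁ - M.β) / 2 * q ^ 2 := by
  unfold surplus
  have : ∀ y : ℝ, (M.β * y + M.f x + e) - (s + M.α₁ * y) - a
      = (M.f x + e - s - a) - (M.α₁ - M.β) * y := fun y => by ring
  simp only [this]
  rw [intervalIntegral.integral_sub (by simp) (by apply Continuous.intervalIntegrable; fun_prop),
    intervalIntegral.integral_const_mul, integral_id, intervalIntegral.integral_const, smul_eq_mul]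
  ring

/-- Myopic buyers are exactly the truthful ones; in particular they exist. -/
theorem isMyopic_iff (b : Buyer d) :
    M.IsMyopic b ↔ ∀ t h x s a e, b t h x s a e = 0 := by
  have hm : 0 < M.α₁ - M.β := by have := M.α₁_nonneg; have := M.β_neg; linarith
  have key : ∀ s x a e ξ, M.surplus s x a e (M.quantity s x a e ξ)
      = ((M.f x + e - s - a) ^ 2 - ξ ^ 2) / (2 * (M.α₁ - M.β)) := by
    intro s x a e ξ
    rw [surplus_eq]; unfold quantity
    field_simp
    ring
  constructor
  · intro h t hh x s a e
    have h1 := h t hh x s a e 0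
    rw [key, key, div_le_div_iff_of_pos_right (by positivity)] at h1
    have : (b t hh x s a e) ^ 2 ≤ 0 := by linarith
    exact pow_eq_zero_iff (two_ne_zero) |>.1 (le_antisymm this (sq_nonneg _))
  · intro h t hh x s a e ξ
    rw [h, key, key, div_le_div_iff_of_pos_right (by positivity)]
    nlinarith [sq_nonneg ξ]

/-- `a` is an optimal fee of the clairvoyant platform facing truthful demand: among
nonnegative fees it maximizes the expected revenue, over the demand noise, given the feature
and the supply curve. -/
def IsOptFee (s : ℝ) (x : Fin d → ℝ) (a : ℝ) : Prop :=
  0 ≤ a ∧ ∀ a', 0 ≤ a' →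
    ∫ e, a' * M.quantity s x a' e 0 ∂M.demandNoise ≤ ∫ e, a * M.quantity s x a e 0 ∂M.demandNoise

/-- The optimal fee. -/
def optFee (s : ℝ) (x : Fin d → ℝ) : ℝ := Classical.epsilon (M.IsOptFee s x)

theorem expRevenue_eq (s : ℝ) (x : Fin d → ℝ) (a : ℝ) :
    ∫ e, a * M.quantity s x a e 0 ∂M.demandNoise = a * (M.f x - s - a) / (M.α₁ - M.β) := by
  have := M.isProb_demand
  have hi : Integrable (fun e : ℝ => e) M.demandNoise := M.demand_memLp.integrable (by norm_num)
  have : ∀ e : ℝ, a * M.quantity s x a e 0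
      = a * (M.f x - s - a) / (M.α₁ - M.β) + a / (M.α₁ - M.β) * e := by
    intro e; unfold quantity; ring
  simp only [this]
  rw [integral_add (integrable_const _) (hi.const_mul _), integral_const_mul, M.demand_mean]
  simp

/-- The optimal fee exists and is unique. -/
theorem isOptFee_iff (s : ℝ) (x : Fin d → ℝ) (a : ℝ) :
    M.IsOptFee s x a ↔ a = max 0 ((M.f x - s) / 2) := by
  have hm : 0 < M.α₁ - M.β := by have := M.α₁_nonneg; have := M.β_neg; linarith
  unfold IsOptFee
  simp only [expRevenue_eq, div_le_div_iff_of_pos_right hm]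
  constructor
  · rintro ⟨h0, h⟩
    have h1 := h _ (le_max_left 0 ((M.f x - s) / 2))
    rcases le_total 0 ((M.f x - s) / 2) with h2 | h2
    · rw [max_eq_right h2] at h1 ⊢
      have : (a - (M.f x - s) / 2) ^ 2 ≤ 0 := by nlinarith
      have := pow_eq_zero_iff (two_ne_zero) |>.1 (le_antisymm this (sq_nonneg _))
      linarith
    · rw [max_eq_left h2] at h1 ⊢
      nlinarith
  · rintro rfl
    refine ⟨le_max_left _ _, fun a' ha' => ?_⟩
    rcases le_total 0 ((M.f x - s) / 2) with h2 | h2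
    · rw [max_eq_right h2]; nlinarith [sq_nonneg (a' - (M.f x - s) / 2)]
    · rw [max_eq_left h2]; nlinarith

theorem optFee_eq (s : ℝ) (x : Fin d → ℝ) : M.optFee s x = max 0 ((M.f x - s) / 2) :=
  (M.isOptFee_iff s x _).1 (Classical.epsilon_spec ⟨_, (M.isOptFee_iff s x _).2 rfl⟩)

/-- The observations of the first `t` rounds when `π` plays against `b`, as a function of the
seed and of the sequence of shocks. -/
def history (π : Policy d) (b : Buyer d) (u : π.Seed) (z : ℕ → Shock d) :
    (t : ℕ) → Fin t → Obs d
  | 0 => Fin.elim0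
  | t + 1 =>
    let h := history π b u z t
    let x := (z t).1
    let s := M.α₀ + (z t).2.1
    let e := (z t).2.2
    let a := π.fee t u h x s
    let ξ := b t h x s a e
    Fin.snoc (α := fun _ => Obs d) h (s, x, M.price s x a e ξ, M.quantity s x a e ξ)

/-- The revenue loss of round `t`:
`a_t^* Q(P_S, P_D, a_t^*) - a_t Q(P_S, P'_D, a_t)`. -/
def roundLoss (π : Policy d) (b : Buyer d) (t : ℕ) (w : π.Seed × (ℕ → Shock d)) : ℝ :=
  let h := M.history π b w.1 w.2 t
  let x := (w.2 t).1
  let s := M.α₀ + (w.2 t).2.1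
  let e := (w.2 t).2.2
  let a := π.fee t w.1 h x s
  let ξ := b t h x s a e
  M.optFee s x * M.quantity s x (M.optFee s x) e 0 - a * M.quantity s x a e ξ

/-- The joint law of the shocks of one round. -/
def shockLaw : Measure (Shock d) := M.featureLaw.prod (M.supplyNoise.prod M.demandNoise)

/-- The joint law of the seed and of the i.i.d. sequence of shocks. -/
def law (π : Policy d) : Measure (π.Seed × (ℕ → Shock d)) :=
  π.seedLaw.prod (Measure.infinitePi (fun _ : ℕ => M.shockLaw))

/-- The expected regret of `π` over `T` rounds against the buyer `b`. -/
def regret (π : Policy d) (b : Buyer d) (T : ℕ) : EReal :=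
  ∑ t ∈ Finset.range T, extExpect (M.law π) (M.roundLoss π b t)

end Market

end ServiceFee

end

namespace ServiceFee

/-! The proof is a two-point argument around an uninformative fee. A myopic buyer is truthful, so
with constant `f = r`, no supply noise, and slope `m = α₁ - β`, the mean quantity at fee `y` is `(r
- α₀ - y) / m`. Writing `r - α₀ = 2a`, the optimal fee is `a`, and playing `y` costs `(y - a)² / m`
on average (`sqDev_le_extExpect_roundLoss`).

The second market has slope `m (1 + θ)` and excess demand `2a + aθ`. Both markets have mean quantity
`a / m` at fee `a`, and their means at fee `y` differ by at most `θ |y - a| / m`; the optimal fee of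
the second is `a + aθ/2`. The noise variances are tuned so that the quantity has the same variance
`v` in both. Hence information is gained only by fees away from `a`, and each such fee is paid for
in regret.

With `θ = η T^(-1/4)`, suppose that the regret is below `c √T` in both markets. Then the squared
deviations from `a`, summed over the rounds, are `O(√T)`, including the recentring cost `T (aθ/2)²`.
The Hellinger affinity of the two histories loses at most a multiple of `θ²` times this sum, so it
stays at least `3/4` (`exists_logLikelihoodRatio`). No fee can then be close to both optimal fees
under the respective laws (`affinity_le_sqDev`), and each round costs order `(aθ)²`, in total order
`T θ² = η² √T`, a contradiction for small `c` (`lt_sum_sqDev`, `le_regret_or_le_regret`). -/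

instance {d : ℕ} (M : Market d) : IsProbabilityMeasure M.featureLaw := M.isProb_feature
instance {d : ℕ} (M : Market d) : IsProbabilityMeasure M.supplyNoise := M.isProb_supply
instance {d : ℕ} (M : Market d) : IsProbabilityMeasure M.demandNoise := M.isProb_demand
instance {d : ℕ} (π : Policy d) : IsProbabilityMeasure π.seedLaw := π.isProb_seed
instance {d : ℕ} (M : Market d) : IsProbabilityMeasure M.shockLaw := by
  unfold Market.shockLaw; infer_instance
instance {d : ℕ} (M : Market d) (π : Policy d) : IsProbabilityMeasure (M.law π) := by
  unfold Market.law; infer_instance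

/-! ### Change of mean and Hellinger affinity for Gaussian laws. -/

section Gaussian

open scoped NNReal

/-- The log-likelihood ratio of `N(b, v)` against `N(a, v)` at `q`. -/
noncomputable def gaussianLogRatio (a b v q : ℝ) : ℝ := ((q - a) ^ 2 - (q - b) ^ 2) / (2 * v)

@[fun_prop]
theorem measurable_gaussianLogRatio {X : Type*} [MeasurableSpace X] {a b q : X → ℝ} (v : ℝ)
    (ha : Measurable a) (hb : Measurable b) (hq : Measurable q) :
    Measurable (fun x => gaussianLogRatio (a x) (b x) v (q x)) := by
  unfold gaussianLogRatio; fun_prop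

theorem lintegral_gaussianReal_shift (a b : ℝ) {v : ℝ≥0} (hv : v ≠ 0) {F : ℝ → ENNReal}
    (hF : Measurable F) :
    ∫⁻ q, F q ∂gaussianReal b v
      = ∫⁻ q, ENNReal.ofReal (Real.exp (gaussianLogRatio a b v q)) * F q ∂gaussianReal a v := by
  have hv' : (v : ℝ) ≠ 0 := by simpa using hv
  rw [gaussianReal_of_var_ne_zero _ hv, gaussianReal_of_var_ne_zero _ hv,
    lintegral_withDensity_eq_lintegral_mul _ (measurable_gaussianPDF _ _) hF,
    lintegral_withDensity_eq_lintegral_mul _ (measurable_gaussianPDF _ _) (by fun_prop)]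
  refine lintegral_congr fun q => ?_
  simp only [Pi.mul_apply, ← mul_assoc]
  congr 1
  rw [gaussianPDF, gaussianPDF, ← ENNReal.ofReal_mul (gaussianPDFReal_nonneg _ _ _),
    gaussianPDFReal, gaussianPDFReal, mul_assoc (_)⁻¹ (Real.exp _) (Real.exp _), ← Real.exp_add]
  congr 3
  unfold gaussianLogRatio
  field_simp
  ring

/-- The Hellinger affinity of two Gaussian laws with the same variance. -/
theorem lintegral_exp_half_gaussianLogRatio (a b : ℝ) {v : ℝ≥0} (hv : v ≠ 0) :
    ∫⁻ q, ENNReal.ofReal (Real.exp (gaussianLogRatio a b v q / 2)) ∂gaussianReal a v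
      = ENNReal.ofReal (Real.exp (-((a - b) ^ 2 / (8 * v)))) := by
  have hv' : (v : ℝ) ≠ 0 := by simpa using hv
  -- Completing the square: the root of the density ratio is, up to the constant `exp (-(a - b)² /
  -- (8v))`, the density ratio of the Gaussian centred at the midpoint, which integrates to 1.
  have h := lintegral_gaussianReal_shift a ((a + b) / 2) hv (F := fun _ => 1) measurable_const
  simp only [lintegral_one, measure_univ, mul_one] at h
  have h2 : ∀ q, ENNReal.ofReal (Real.exp (gaussianLogRatio a b v q / 2))
      = ENNReal.ofReal (Real.exp (-((a - b) ^ 2 / (8 * v))))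
        * ENNReal.ofReal (Real.exp (gaussianLogRatio a ((a + b) / 2) v q)) := by
    intro q
    rw [← ENNReal.ofReal_mul (Real.exp_nonneg _), ← Real.exp_add]
    congr 2
    unfold gaussianLogRatio
    field_simp
    ring
  simp_rw [h2]
  rw [lintegral_const_mul _ (by fun_prop), ← h, mul_one]

theorem stronglyLogConcave_gaussianReal {v : ℝ≥0} (hv : v ≠ 0) :
    StronglyLogConcave (gaussianReal 0 v) := by
  have hv' : (0 : ℝ) < v := by positivity
  refine ⟨Set.univ, 1 / v, fun e => e ^ 2 / (2 * v) + Real.log (Real.sqrt (2 * Real.pi * v)),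
    convex_univ, by positivity, ?_, ?_⟩
  · rw [strongConvexOn_iff_convex]
    have : (fun x : ℝ => x ^ 2 / (2 * v) + Real.log (Real.sqrt (2 * Real.pi * v))
        - 1 / (v : ℝ) / 2 * ‖x‖ ^ 2) = fun _ => Real.log (Real.sqrt (2 * Real.pi * v)) := by
      funext x
      rw [Real.norm_eq_abs, sq_abs]
      field_simp
      ring
    rw [this]
    exact convexOn_const _ convex_univ
  · rw [Measure.restrict_univ, gaussianReal_of_var_ne_zero _ hv]
    congr 1
    funext e
    rw [gaussianPDF, gaussianPDFReal]
    congr 1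
    rw [neg_add, Real.exp_add, Real.exp_neg (Real.log _), Real.exp_log (by positivity), mul_comm]
    congr 2
    ring

end Gaussian

/-! ### Law of the history and its independence of the current shock. -/

/-- The buyer who reports the true demand curve. -/
def truthful (d : ℕ) : Buyer d := fun _ _ _ _ _ _ => 0

namespace Market

variable {d : ℕ} (M : Market d) (π : Policy d)

theorem eq_truthful_of_isMyopic {b : Buyer d} (h : M.IsMyopic b) : b = truthful d := by
  funext t hh x s a e
  exact (M.isMyopic_iff b).1 h t hh x s a e

theorem history_congr (b : Buyer d) (u : π.Seed) {z z' : ℕ → Shock d} (t : ℕ)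
    (h : ∀ i < t, z i = z' i) : M.history π b u z t = M.history π b u z' t := by
  induction t with
  | zero => rfl
  | succ t ih =>
    have h1 := ih fun i hi => h i (by omega)
    simp only [history, h1, h t (by omega)]

theorem measurable_finSnoc {n : ℕ} {X α : Type*} [MeasurableSpace X] [MeasurableSpace α]
    {f : X → Fin n → α} {g : X → α} (hf : Measurable f) (hg : Measurable g) :
    Measurable (fun x => (Fin.snoc (α := fun _ => α) (f x) (g x) : Fin (n + 1) → α)) := by
  refine measurable_pi_iff.2 fun i => ?_
  refine Fin.lastCases ?_ (fun j => ?_) i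
  · simpa using hg
  · simpa only [Fin.snoc_castSucc] using measurable_pi_iff.1 hf j

theorem measurable_fee_comp {X : Type*} [MeasurableSpace X] (t : ℕ) {u : X → π.Seed}
    {h : X → Fin t → Obs d} {x : X → Fin d → ℝ} {s : X → ℝ} (hu : Measurable u)
    (hh : Measurable h) (hx : Measurable x) (hs : Measurable s) :
    Measurable (fun w => π.fee t (u w) (h w) (x w) (s w)) :=
  (π.measurable_fee t).comp (hu.prodMk (hh.prodMk (hx.prodMk hs)))

theorem measurable_quantity_comp {X : Type*} [MeasurableSpace X]
    {s a e : X → ℝ} {x : X → Fin d → ℝ} (hs : Measurable s) (hx : Measurable x)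
    (ha : Measurable a) (he : Measurable e) :
    Measurable (fun w => M.quantity (s w) (x w) (a w) (e w) 0) := by
  have := M.measurable_f.comp hx
  unfold quantity
  exact (((((this.add he).add measurable_const).sub hs).sub ha).div measurable_const)

theorem measurable_history (t : ℕ) :
    Measurable (fun w : π.Seed × (ℕ → Shock d) => M.history π (truthful d) w.1 w.2 t) := by
  induction t with
  | zero => exact measurable_const
  | succ t ih =>
    have hx : Measurable (fun w : π.Seed × (ℕ → Shock d) => (w.2 t).1) := by fun_prop
    have hs : Measurable (fun w : π.Seed × (ℕ → Shock d) => M.α₀ + (w.2 t).2.1) := by fun_prop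
    have he : Measurable (fun w : π.Seed × (ℕ → Shock d) => (w.2 t).2.2) := by fun_prop
    have ha := measurable_fee_comp π t measurable_fst ih hx hs
    have hq := M.measurable_quantity_comp hs hx ha he
    exact measurable_finSnoc ih
      (hs.prodMk (hx.prodMk (((hs.add (hq.const_mul M.α₁)).add ha).prodMk hq)))

/-- The joint law of the seed and of the observations of the first `t` rounds. -/
noncomputable def histLaw (t : ℕ) : Measure (π.Seed × (Fin t → Obs d)) :=
  (M.law π).map (fun w => (w.1, M.history π (truthful d) w.1 w.2 t))

instance (t : ℕ) : IsProbabilityMeasure (M.histLaw π t) :=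
  Measure.isProbabilityMeasure_map
    (measurable_fst.prodMk (M.measurable_history π t)).aemeasurable

/-- The observations of the earlier rounds are independent of the current shock. -/
theorem map_history_shock (t : ℕ) :
    (M.law π).map (fun w => ((w.1, M.history π (truthful d) w.1 w.2 t), w.2 t))
      = (M.histLaw π t).prod M.shockLaw := by
  have hH := M.measurable_history π t
  have hseed : ∀ u : π.Seed,
      Measurable (fun z : ℕ → Shock d => M.history π (truthful d) u z t) := fun u =>
    hH.comp measurable_prodMk_left
  have hindep : ∀ u : π.Seed,
      IndepFun (fun z : ℕ → Shock d => M.history π (truthful d) u z t) (fun z => z t)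
        (Measure.infinitePi fun _ : ℕ => M.shockLaw) := by
    intro u
    have hi : iIndepFun (fun (i : ℕ) (z : ℕ → Shock d) => z i)
        (Measure.infinitePi fun _ : ℕ => M.shockLaw) := by
      have := iIndepFun_infinitePi (P := fun _ : ℕ => M.shockLaw) (X := fun _ s => s)
        (fun _ => measurable_id)
      exact this
    have h1 := hi.indepFun_finset (Finset.range t) {t} (by simp) (fun i => measurable_pi_apply i)
    -- The history sees only the shocks before `t`. Padding them with the irrelevant value 0
    -- exhibits it as a function of finitely many coordinates.
    let ext : (Finset.range t → Shock d) → ℕ → Shock d :=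
      fun y i => if h : i ∈ Finset.range t then y ⟨i, h⟩ else 0
    have hext : Measurable ext := by
      refine measurable_pi_iff.2 fun i => ?_
      by_cases h : i ∈ Finset.range t
      · simp only [ext, h, dite_true]; exact measurable_pi_apply _
      · simp only [ext, h, dite_false]; exact measurable_const
    have h2 := h1.comp ((hseed u).comp hext)
      (measurable_pi_apply (⟨t, by simp⟩ : ({t} : Finset ℕ)))
    refine (h2.congr (Filter.Eventually.of_forall fun z => ?_)
      (Filter.Eventually.of_forall fun z => rfl))
    exact M.history_congr π _ u t fun i hi => by simp [ext, hi]
  refine Measure.ext_of_lintegral _ fun F hF => ?_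
  have hpair : Measurable (fun w : π.Seed × (ℕ → Shock d) =>
      ((w.1, M.history π (truthful d) w.1 w.2 t), w.2 t)) := by fun_prop
  rw [lintegral_map hF hpair, lintegral_prod _ hF.aemeasurable, histLaw,
    lintegral_map hF.lintegral_prod_right' (measurable_fst.prodMk hH), law,
    lintegral_prod (fun w : π.Seed × (ℕ → Shock d) =>
      F ((w.1, M.history π (truthful d) w.1 w.2 t), w.2 t)) (hF.comp hpair).aemeasurable,
    lintegral_prod (fun w : π.Seed × (ℕ → Shock d) =>
      ∫⁻ y, F ((w.1, M.history π (truthful d) w.1 w.2 t), y) ∂M.shockLaw)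
      (hF.lintegral_prod_right'.comp (measurable_fst.prodMk hH)).aemeasurable]
  refine lintegral_congr fun u => ?_
  have h3 := (hindep u).map_prod_eq_prod_map_map (hseed u).aemeasurable
    (measurable_pi_apply t).aemeasurable
  have hFu : Measurable (fun y : (Fin t → Obs d) × Shock d => F ((u, y.1), y.2)) := by fun_prop
  have h4 := lintegral_map (μ := Measure.infinitePi fun _ : ℕ => M.shockLaw) hFu
    ((hseed u).prodMk (measurable_pi_apply t))
  rw [← h4, h3, lintegral_prod _ hFu.aemeasurable,
    lintegral_map hFu.lintegral_prod_right' (hseed u), Measure.infinitePi_map_eval]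

theorem lintegral_law_history_shock (t : ℕ)
    {F : (π.Seed × (Fin t → Obs d)) × Shock d → ENNReal} (hF : Measurable F) :
    ∫⁻ w, F ((w.1, M.history π (truthful d) w.1 w.2 t), w.2 t) ∂M.law π
      = ∫⁻ p, ∫⁻ s, F (p, s) ∂M.shockLaw ∂M.histLaw π t := by
  have hH := M.measurable_history π t
  have hpair : Measurable (fun w : π.Seed × (ℕ → Shock d) =>
      ((w.1, M.history π (truthful d) w.1 w.2 t), w.2 t)) := by fun_prop
  rw [← lintegral_prod _ hF.aemeasurable, ← M.map_history_shock π t, lintegral_map hF hpair]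

theorem histLaw_zero (M' : Market d) : M.histLaw π 0 = M'.histLaw π 0 := by
  have : ∀ N : Market d, N.histLaw π 0 = π.seedLaw.map (fun u => (u, Fin.elim0)) := by
    intro N
    have h : (fun w : π.Seed × (ℕ → Shock d) => (w.1, N.history π (truthful d) w.1 w.2 0))
        = (fun u => (u, Fin.elim0)) ∘ Prod.fst := rfl
    rw [histLaw, h, ← Measure.map_map (by fun_prop) measurable_fst, law, Measure.map_fst_prod]
    simp
  rw [this M, this M']

end Market

end ServiceFee

/-! ### Regret as mean square deviation from the optimal fee. -/

namespace ServiceFee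

open scoped NNReal

/-- The cross term `Y e` has mean zero by independence, but fees need not be integrable. The
argument splits on whether the positive part has infinite expectation; if it is finite, `Y` turns
out to be square integrable. -/
theorem le_extExpect_quadratic {Ω : Type*} [MeasurableSpace Ω] (ν : Measure Ω)
    [IsProbabilityMeasure ν] (D : Measure ℝ) [IsProbabilityMeasure D]
    (hL2 : MemLp (fun e : ℝ => e) 2 D) (hmean : ∫ e, e ∂D = 0) {Y : Ω → ℝ} (hY : Measurable Y)
    {m : ℝ} (hm : 0 < m) :
    ((∫⁻ y, ENNReal.ofReal (Y y ^ 2 / m) ∂ν : ENNReal) : EReal) ≤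
      extExpect (ν.prod D) (fun z => (Y z.1 ^ 2 - Y z.1 * z.2) / m) := by
  set g : Ω × ℝ → ℝ := fun z => (Y z.1 ^ 2 - Y z.1 * z.2) / m with hg
  have hgm : Measurable g := by fun_prop
  have hsq : Integrable (fun z : Ω × ℝ => z.2 ^ 2) (ν.prod D) := hL2.integrable_sq.comp_snd ν
  -- Minimizing `Y² - Y e` over `Y` gives `-e² / 4`, so the negative part is dominated whatever the
  -- fees are.
  have hneg : ∫⁻ z, ENNReal.ofReal (-g z) ∂ν.prod D ≠ ⊤ := by
    refine ne_top_of_le_ne_top (hsq.div_const (4 * m)).lintegral_lt_top.ne (lintegral_mono fun z => ?_)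
    refine ENNReal.ofReal_le_ofReal ?_
    rw [hg, ← neg_div, div_le_div_iff₀ hm (by positivity)]
    nlinarith [mul_nonneg hm.le (sq_nonneg (2 * Y z.1 - z.2))]
  unfold extExpect
  by_cases hpos : ∫⁻ z, ENNReal.ofReal (g z) ∂ν.prod D = ⊤
  · rw [hpos]
    lift (∫⁻ z, ENNReal.ofReal (-g z) ∂ν.prod D) to ℝ≥0 using hneg with c
    exact le_top
  · have hgi : Integrable g (ν.prod D) := by
      refine ⟨hgm.aestronglyMeasurable, ?_⟩
      rw [hasFiniteIntegral_iff_norm]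
      have : ∀ z, ENNReal.ofReal ‖g z‖ ≤ ENNReal.ofReal (g z) + ENNReal.ofReal (-g z) := by
        intro z
        rcases le_total 0 (g z) with h | h
        · rw [Real.norm_of_nonneg h]; exact le_self_add
        · rw [Real.norm_of_nonpos h]; exact le_add_self
      refine (lintegral_mono this).trans_lt ?_
      rw [lintegral_add_left hgm.ennreal_ofReal]
      exact ENNReal.add_lt_top.2 ⟨lt_top_iff_ne_top.2 hpos, lt_top_iff_ne_top.2 hneg⟩
    -- From `(Y - e)² ≥ 0` one gets `Y² ≤ 2 (Y² - Y e) + e²`.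
    have hY2 : Integrable (fun z : Ω × ℝ => Y z.1 ^ 2) (ν.prod D) := by
      refine ((hgi.const_mul (2 * m)).add hsq).mono'
        ((hY.comp measurable_fst).pow_const 2 |>.aestronglyMeasurable) (.of_forall fun z => ?_)
      rw [Real.norm_of_nonneg (sq_nonneg _)]
      have : 2 * m * g z = 2 * (Y z.1 ^ 2 - Y z.1 * z.2) := by rw [hg]; field_simp
      simp only [Pi.add_apply, this]
      nlinarith [sq_nonneg (Y z.1 - z.2)]
    have hYe : Integrable (fun z : Ω × ℝ => Y z.1 * z.2) (ν.prod D) :=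
      ((memLp_two_iff_integrable_sq (hY.comp measurable_fst).aestronglyMeasurable).2 hY2).integrable_mul
        ((memLp_two_iff_integrable_sq (by fun_prop)).2 hsq)
    have hmeanYe : ∫ z : Ω × ℝ, Y z.1 * z.2 ∂ν.prod D = 0 := by
      rw [integral_prod_mul Y (fun e => e), hmean, mul_zero]
    have hint : ∫ z, g z ∂ν.prod D = ∫ z : Ω × ℝ, Y z.1 ^ 2 / m ∂ν.prod D := by
      simp only [hg, sub_div]
      rw [integral_sub (hY2.div_const m) (hYe.div_const m), integral_div m (fun z : Ω × ℝ => Y z.1 * z.2),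
        hmeanYe, zero_div, sub_zero]
    have hleft : ∫⁻ y, ENNReal.ofReal (Y y ^ 2 / m) ∂ν
        = ENNReal.ofReal (∫ z, g z ∂ν.prod D) := by
      rw [hint, ofReal_integral_eq_lintegral_ofReal (hY2.div_const m)
        (.of_forall fun z => by positivity), lintegral_prod _ (by fun_prop)]
      simp
    have hnn : 0 ≤ ∫ z, g z ∂ν.prod D := by
      rw [hint]; exact integral_nonneg fun z => by positivity
    rw [hleft, EReal.coe_ennreal_ofReal, max_eq_left hnn,
      integral_eq_lintegral_pos_part_sub_lintegral_neg_part hgi]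
    lift (∫⁻ z, ENNReal.ofReal (-g z) ∂ν.prod D) to ℝ≥0 using hneg with c
    lift (∫⁻ z, ENNReal.ofReal (g z) ∂ν.prod D) to ℝ≥0 using hpos with c'
    exact le_of_eq (by simp; rfl)

namespace Market

variable {d : ℕ} (M : Market d) (π : Policy d)

theorem slope_pos : 0 < M.α₁ - M.β := by have := M.α₁_nonneg; have := M.β_neg; linarith

/-- The mean square deviation of the fee of round `t` from `a`. -/
noncomputable def sqDev (t : ℕ) (a : ℝ) : ENNReal :=
  ∫⁻ p, ∫⁻ x, ENNReal.ofReal ((π.fee t p.1 p.2 x M.α₀ - a) ^ 2) ∂M.featureLaw ∂M.histLaw π t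

theorem measurable_fee_prod (t : ℕ) :
    Measurable (fun y : (π.Seed × (Fin t → Obs d)) × (Fin d → ℝ) =>
      π.fee t y.1.1 y.1.2 y.2 M.α₀) :=
  measurable_fee_comp π t (by fun_prop) (by fun_prop) (by fun_prop) measurable_const

variable {M}

theorem lintegral_shockLaw (hS : M.supplyNoise = Measure.dirac 0) {F : Shock d → ENNReal}
    (hF : Measurable F) :
    ∫⁻ s, F s ∂M.shockLaw = ∫⁻ x, ∫⁻ e, F (x, 0, e) ∂M.demandNoise ∂M.featureLaw := by
  rw [shockLaw, lintegral_prod _ hF.aemeasurable]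
  refine lintegral_congr fun x => ?_
  rw [lintegral_prod _ (by fun_prop), hS, lintegral_dirac' _ ?_]
  exact Measurable.lintegral_prod_right' (f := fun y : ℝ × ℝ => F (x, y.1, y.2)) (by fun_prop)

/-- The revenue is quadratic in the fee, so its loss against the maximizer `a₀` is `((a - a₀)² - (a
- a₀) e) / m`. The condition `α₀ ≤ r` keeps the maximizer off the constraint `a ≥ 0`. -/
theorem sqDev_le_extExpect_roundLoss (hS : M.supplyNoise = Measure.dirac 0) {r : ℝ}
    (hf : M.f = fun _ => r) (hr : M.α₀ ≤ r) (t : ℕ) :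
    ((ENNReal.ofReal (M.α₁ - M.β)⁻¹ * M.sqDev π t ((r - M.α₀) / 2) : ENNReal) : EReal) ≤
      extExpect (M.law π) (M.roundLoss π (truthful d) t) := by
  have hm := M.slope_pos
  set m := M.α₁ - M.β with hmdef
  set a₀ := (r - M.α₀) / 2 with ha₀
  set ν := (M.histLaw π t).prod M.featureLaw
  set Y : (π.Seed × (Fin t → Obs d)) × (Fin d → ℝ) → ℝ := fun y =>
    π.fee t y.1.1 y.1.2 y.2 M.α₀ - a₀ with hY
  have hYm : Measurable Y := (M.measurable_fee_prod π t).sub_const a₀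
  let G : (π.Seed × (Fin t → Obs d)) × Shock d → ℝ := fun y =>
    max 0 ((r - (M.α₀ + y.2.2.1)) / 2) * M.quantity (M.α₀ + y.2.2.1) y.2.1
      (max 0 ((r - (M.α₀ + y.2.2.1)) / 2)) y.2.2.2 0
    - π.fee t y.1.1 y.1.2 y.2.1 (M.α₀ + y.2.2.1) * M.quantity (M.α₀ + y.2.2.1) y.2.1
      (π.fee t y.1.1 y.1.2 y.2.1 (M.α₀ + y.2.2.1)) y.2.2.2 0
  have hGm : Measurable G := by
    have h1 : Measurable (fun y : (π.Seed × (Fin t → Obs d)) × Shock d =>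
        π.fee t y.1.1 y.1.2 y.2.1 (M.α₀ + y.2.2.1)) :=
      measurable_fee_comp π t (by fun_prop) (by fun_prop) (by fun_prop) (by fun_prop)
    have h2 : Measurable (fun y : (π.Seed × (Fin t → Obs d)) × Shock d =>
        max 0 ((r - (M.α₀ + y.2.2.1)) / 2)) := by fun_prop
    exact (h2.mul (M.measurable_quantity_comp (by fun_prop) (by fun_prop) h2 (by fun_prop))).sub
      (h1.mul (M.measurable_quantity_comp (by fun_prop) (by fun_prop) h1 (by fun_prop)))
  have hloss : ∀ w : π.Seed × (ℕ → Shock d), M.roundLoss π (truthful d) t w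
      = G ((w.1, M.history π (truthful d) w.1 w.2 t), w.2 t) := by
    intro w
    simp only [roundLoss, optFee_eq, hf, truthful, G]
  have hG0 : ∀ p x e, G (p, (x, 0, e)) = (Y (p, x) ^ 2 - Y (p, x) * e) / m := by
    intro p x e
    simp only [G, add_zero, quantity, hf, hY, ← ha₀, ← hmdef]
    rw [max_eq_right (by rw [ha₀]; linarith)]
    have : r = 2 * a₀ + M.α₀ := by rw [ha₀]; ring
    rw [this]
    field_simp
    ring
  have key : ∀ φ : ℝ → ENNReal, Measurable φ →
      ∫⁻ w, φ (M.roundLoss π (truthful d) t w) ∂M.law π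
        = ∫⁻ z, φ ((Y z.1 ^ 2 - Y z.1 * z.2) / m) ∂ν.prod M.demandNoise := by
    intro φ hφ
    simp only [hloss]
    rw [M.lintegral_law_history_shock π t (F := fun y => φ (G y)) (hφ.comp hGm)]
    have h1 : ∀ p, ∫⁻ s, φ (G (p, s)) ∂M.shockLaw
        = ∫⁻ x, ∫⁻ e, φ ((Y (p, x) ^ 2 - Y (p, x) * e) / m) ∂M.demandNoise ∂M.featureLaw := by
      intro p
      rw [lintegral_shockLaw hS (F := fun s => φ (G (p, s)))
        (hφ.comp (hGm.comp measurable_prodMk_left))]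
      simp only [hG0]
    have h2 : Measurable (fun z : ((π.Seed × (Fin t → Obs d)) × (Fin d → ℝ)) × ℝ =>
        φ ((Y z.1 ^ 2 - Y z.1 * z.2) / m)) := hφ.comp (by fun_prop)
    simp only [h1]
    rw [lintegral_prod _ h2.aemeasurable, lintegral_prod _ h2.lintegral_prod_right'.aemeasurable]
  have hext : extExpect (M.law π) (M.roundLoss π (truthful d) t)
      = extExpect (ν.prod M.demandNoise) (fun z => (Y z.1 ^ 2 - Y z.1 * z.2) / m) := by
    unfold extExpect
    rw [key (fun v => ENNReal.ofReal v) (by fun_prop),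
      key (fun v => ENNReal.ofReal (-v)) (by fun_prop)]
  rw [hext]
  refine le_trans (le_of_eq ?_)
    (le_extExpect_quadratic ν M.demandNoise M.demand_memLp M.demand_mean hYm hm)
  congr 1
  have h3 : ∀ y, ENNReal.ofReal (Y y ^ 2 / m) = ENNReal.ofReal m⁻¹ * ENNReal.ofReal (Y y ^ 2) := by
    intro y
    rw [← ENNReal.ofReal_mul (by positivity), div_eq_inv_mul]
  simp only [h3]
  rw [lintegral_const_mul _ (by fun_prop), lintegral_prod _ (by fun_prop)]
  rfl

theorem sum_sqDev_le_regret (hS : M.supplyNoise = Measure.dirac 0) {r : ℝ}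
    (hf : M.f = fun _ => r) (hr : M.α₀ ≤ r) (T : ℕ) :
    ((ENNReal.ofReal (M.α₁ - M.β)⁻¹ *
      ∑ t ∈ Finset.range T, M.sqDev π t ((r - M.α₀) / 2) : ENNReal) : EReal) ≤
      M.regret π (truthful d) T := by
  unfold regret
  rw [Finset.mul_sum]
  induction T with
  | zero => simp
  | succ T ih =>
    rw [Finset.sum_range_succ, Finset.sum_range_succ, EReal.coe_ennreal_add]
    exact add_le_add ih (sqDev_le_extExpect_roundLoss π hS hf hr T)

/-! ### One-round recursion for the law of the history. -/

/-- The mean traded quantity given the feature and the fee. -/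
noncomputable def meanQuantity (M : Market d) (x : Fin d → ℝ) (a : ℝ) : ℝ :=
  (M.f x - M.α₀ - a) / (M.α₁ - M.β)

theorem measurable_meanQuantity_comp {X : Type*} [MeasurableSpace X] {x : X → Fin d → ℝ}
    {a : X → ℝ} (hx : Measurable x) (ha : Measurable a) :
    Measurable (fun w => M.meanQuantity (x w) (a w)) := by
  have := M.measurable_f.comp hx
  unfold meanQuantity
  exact ((this.sub measurable_const).sub ha).div measurable_const

/-- The observations after one more round with feature `x` and traded quantity `q`, when the
supply curve is `α₀ + α₁ Q`. -/
noncomputable def appendRound (α₀ α₁ : ℝ) (π : Policy d) (t : ℕ) (p : π.Seed × (Fin t → Obs d))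
    (x : Fin d → ℝ) (q : ℝ) : π.Seed × (Fin (t + 1) → Obs d) :=
  (p.1, Fin.snoc (α := fun _ => Obs d) p.2 (α₀, x, α₀ + α₁ * q + π.fee t p.1 p.2 x α₀, q))

theorem measurable_appendRound_comp {X : Type*} [MeasurableSpace X] (α₀ α₁ : ℝ) (t : ℕ)
    {p : X → π.Seed × (Fin t → Obs d)} {x : X → Fin d → ℝ} {q : X → ℝ}
    (hp : Measurable p) (hx : Measurable x) (hq : Measurable q) :
    Measurable (fun w => appendRound α₀ α₁ π t (p w) (x w) (q w)) := by
  have ha := measurable_fee_comp π t hp.fst hp.snd hx (measurable_const (a := α₀))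
  exact hp.fst.prodMk (measurable_finSnoc hp.snd
    (measurable_const.prodMk (hx.prodMk (((hq.const_mul α₁).const_add α₀ |>.add ha).prodMk hq))))

theorem lintegral_histLaw_succ_noise (hS : M.supplyNoise = Measure.dirac 0) (t : ℕ)
    {F : π.Seed × (Fin (t + 1) → Obs d) → ENNReal} (hF : Measurable F) :
    ∫⁻ y, F y ∂M.histLaw π (t + 1) = ∫⁻ p, ∫⁻ x, ∫⁻ e, F (appendRound M.α₀ M.α₁ π t p x
      (M.quantity M.α₀ x (π.fee t p.1 p.2 x M.α₀) e 0)) ∂M.demandNoise ∂M.featureLaw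
        ∂M.histLaw π t := by
  have hH := M.measurable_history π (t + 1)
  rw [histLaw, lintegral_map hF (measurable_fst.prodMk hH)]
  let G : (π.Seed × (Fin t → Obs d)) × Shock d → π.Seed × (Fin (t + 1) → Obs d) := fun y =>
    (y.1.1, Fin.snoc (α := fun _ => Obs d) y.1.2
      (M.α₀ + y.2.2.1, y.2.1, M.price (M.α₀ + y.2.2.1) y.2.1
        (π.fee t y.1.1 y.1.2 y.2.1 (M.α₀ + y.2.2.1)) y.2.2.2 0,
        M.quantity (M.α₀ + y.2.2.1) y.2.1
        (π.fee t y.1.1 y.1.2 y.2.1 (M.α₀ + y.2.2.1)) y.2.2.2 0))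
  have hGm : Measurable G := by
    have hs : Measurable (fun y : (π.Seed × (Fin t → Obs d)) × Shock d => M.α₀ + y.2.2.1) := by
      fun_prop
    have hx : Measurable (fun y : (π.Seed × (Fin t → Obs d)) × Shock d => y.2.1) := by
      fun_prop
    have ha := measurable_fee_comp π t (measurable_fst.comp measurable_fst)
      (measurable_snd.comp measurable_fst) hx hs
    have hq := M.measurable_quantity_comp hs hx ha
      (e := fun y : (π.Seed × (Fin t → Obs d)) × Shock d => y.2.2.2) (by fun_prop)
    exact (measurable_fst.comp measurable_fst).prodMk
      (measurable_finSnoc (measurable_snd.comp measurable_fst)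
      (hs.prodMk (hx.prodMk (((hs.add (hq.const_mul M.α₁)).add ha).prodMk hq))))
  have h1 : ∀ w : π.Seed × (ℕ → Shock d), F (w.1, M.history π (truthful d) w.1 w.2 (t + 1))
      = (F ∘ G) ((w.1, M.history π (truthful d) w.1 w.2 t), w.2 t) := fun w => rfl
  simp only [h1]
  rw [M.lintegral_law_history_shock π t (hF.comp hGm)]
  refine lintegral_congr fun p => ?_
  rw [lintegral_shockLaw hS (F := fun s => (F ∘ G) (p, s))
    ((hF.comp hGm).comp measurable_prodMk_left)]
  simp only [Function.comp, G, add_zero]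
  rfl

/-- The factor `(α₁ - β)²` in the noise variance cancels the division by the slope. Markets with
different slopes thus give quantities with the same variance, and only their means can tell them
apart. -/
theorem map_quantity_demandNoise {v : ℝ≥0}
    (hD : M.demandNoise = gaussianReal 0 (v * ((M.α₁ - M.β) ^ 2).toNNReal))
    (x : Fin d → ℝ) (a : ℝ) :
    M.demandNoise.map (fun e => M.quantity M.α₀ x a e 0)
      = gaussianReal (M.meanQuantity x a) v := by
  have hm := M.slope_pos.ne'
  have h : (fun e => M.quantity M.α₀ x a e 0)
      = (fun e => M.meanQuantity x a + e) ∘ (fun e => e / (M.α₁ - M.β)) := by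
    funext e
    simp only [quantity, meanQuantity, Function.comp]
    field_simp
    ring
  rw [h, ← Measure.map_map (by fun_prop) (by fun_prop), hD, gaussianReal_map_div_const,
    gaussianReal_map_const_add]
  congr 1
  · simp
  · ext
    simp only [NNReal.coe_div, NNReal.coe_mul, NNReal.coe_mk,
      Real.coe_toNNReal _ (sq_nonneg _)]
    field_simp

/-- The market enters a new round only through the Gaussian mean: given the quantity, the price is
determined by `α₀`, `α₁` and the fee, which carry no information on the demand. -/
theorem lintegral_histLaw_succ (hS : M.supplyNoise = Measure.dirac 0) {v : ℝ≥0}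
    (hD : M.demandNoise = gaussianReal 0 (v * ((M.α₁ - M.β) ^ 2).toNNReal)) (t : ℕ)
    {F : π.Seed × (Fin (t + 1) → Obs d) → ENNReal} (hF : Measurable F) :
    ∫⁻ y, F y ∂M.histLaw π (t + 1) = ∫⁻ p, ∫⁻ x, ∫⁻ q, F (appendRound M.α₀ M.α₁ π t p x q)
      ∂gaussianReal (M.meanQuantity x (π.fee t p.1 p.2 x M.α₀)) v ∂M.featureLaw
        ∂M.histLaw π t := by
  rw [lintegral_histLaw_succ_noise π hS t hF]
  refine lintegral_congr fun p => lintegral_congr fun x => ?_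
  rw [← map_quantity_demandNoise hD, lintegral_map]
  · exact hF.comp (measurable_appendRound_comp π _ _ t measurable_const measurable_const
      measurable_id)
  · exact M.measurable_quantity_comp measurable_const measurable_const measurable_const
      measurable_id

/-- Here the integrating law depends on the history. Pulling it back to the fixed noise law makes
the dependence visible in the integrand alone. -/
theorem measurable_lintegral_appendRound {v : ℝ≥0}
    (hD : M.demandNoise = gaussianReal 0 (v * ((M.α₁ - M.β) ^ 2).toNNReal)) (t : ℕ)
    {F : π.Seed × (Fin (t + 1) → Obs d) → ENNReal} (hF : Measurable F) :
    Measurable fun p => ∫⁻ x, ∫⁻ q, F (appendRound M.α₀ M.α₁ π t p x q)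
      ∂gaussianReal (M.meanQuantity x (π.fee t p.1 p.2 x M.α₀)) v ∂M.featureLaw := by
  have h : ∀ p x, ∫⁻ q, F (appendRound M.α₀ M.α₁ π t p x q)
      ∂gaussianReal (M.meanQuantity x (π.fee t p.1 p.2 x M.α₀)) v
      = ∫⁻ e, F (appendRound M.α₀ M.α₁ π t p x
      (M.quantity M.α₀ x (π.fee t p.1 p.2 x M.α₀) e 0)) ∂M.demandNoise := by
    intro p x
    rw [← map_quantity_demandNoise hD, lintegral_map]
    · exact hF.comp (measurable_appendRound_comp π _ _ t measurable_const measurable_const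
        measurable_id)
    · exact M.measurable_quantity_comp measurable_const measurable_const measurable_const
        measurable_id
  simp only [h]
  have h1 : Measurable (fun z : ((π.Seed × (Fin t → Obs d)) × (Fin d → ℝ)) × ℝ =>
      F (appendRound M.α₀ M.α₁ π t z.1.1 z.1.2
      (M.quantity M.α₀ z.1.2 (π.fee t z.1.1.1 z.1.1.2 z.1.2 M.α₀) z.2 0))) :=
    hF.comp (measurable_appendRound_comp π _ _ t (by fun_prop) (by fun_prop)
      (M.measurable_quantity_comp measurable_const (by fun_prop)
        ((M.measurable_fee_prod π t).comp measurable_fst) measurable_snd))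
  exact h1.lintegral_prod_right'.lintegral_prod_right'

end Market

end ServiceFee

/-! ### Likelihood ratio and affinity of two histories. -/

namespace ServiceFee

open scoped NNReal

/-- One round multiplies the root of the likelihood ratio by `exp (-y)`, a loss of at most `z exp
(l/2)`. By AM-GM `exp (l/2) ≤ (1 + exp l) / 2`, which spreads the loss over both laws. -/
theorem exp_half_le_add {l y z : ℝ} (hyz : y ≤ z) (hz : 0 ≤ z) :
    Real.exp (l / 2) ≤ Real.exp (l / 2) * Real.exp (-y) + z / 2 * (1 + Real.exp l) := by
  have h1 : 1 - z ≤ Real.exp (-y) := by linarith [Real.add_one_le_exp (-y)]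
  have h2 : Real.exp l = Real.exp (l / 2) ^ 2 := by rw [← Real.exp_nat_mul]; congr 1; push_cast; ring
  have h3 := Real.exp_pos (l / 2)
  rw [h2]
  nlinarith [mul_le_mul_of_nonneg_left h1 h3.le, mul_nonneg hz (sq_nonneg (Real.exp (l / 2) - 1))]

theorem _root_.ENNReal.ofReal_mul_add_mul {C y E : ℝ} (hC : 0 ≤ C) (hy : 0 ≤ y) (hE : 0 ≤ E) :
    ENNReal.ofReal (C * y / 2 * (1 + E))
      = ENNReal.ofReal (C / 2) * (ENNReal.ofReal y + ENNReal.ofReal E * ENNReal.ofReal y) := by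
  rw [← ENNReal.ofReal_mul hE, ← ENNReal.ofReal_add hy (by positivity),
    ← ENNReal.ofReal_mul (by positivity)]
  congr 1
  ring

/-- Pointwise form of the two-point bound, with `E²` the likelihood ratio: `y` cannot be near both
`a₁` and `a₂`, which gives `min 1 E²` on the left; replacing this by `E` costs `(1 + E²) / 4`. -/
theorem half_sq_mul_le (a₁ a₂ y : ℝ) {E : ℝ} (hE : 0 < E) :
    (a₁ - a₂) ^ 2 / 2 * E
      ≤ (y - a₁) ^ 2 + (E ^ 2 * (y - a₂) ^ 2 + (a₁ - a₂) ^ 2 / 8 * (1 + E ^ 2)) := by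
  have hD : (a₁ - a₂) ^ 2 / 2 ≤ (y - a₁) ^ 2 + (y - a₂) ^ 2 := by
    nlinarith [sq_nonneg (2 * y - a₁ - a₂)]
  have hD0 : 0 ≤ (a₁ - a₂) ^ 2 / 2 := by positivity
  rcases le_total E 1 with h | h
  · have h3 : E ^ 2 * ((a₁ - a₂) ^ 2 / 2) ≤ (y - a₁) ^ 2 + E ^ 2 * (y - a₂) ^ 2 := by
      have : E ^ 2 ≤ 1 := by nlinarith
      linarith [mul_le_mul_of_nonneg_left hD (sq_nonneg E),
        mul_le_mul_of_nonneg_right this (sq_nonneg (y - a₁))]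
    have h4 : E ≤ E ^ 2 + (1 + E ^ 2) / 4 := by nlinarith [sq_nonneg (5 * E - 2)]
    linarith [mul_le_mul_of_nonneg_left h4 hD0]
  · have h3 : (a₁ - a₂) ^ 2 / 2 ≤ (y - a₁) ^ 2 + E ^ 2 * (y - a₂) ^ 2 := by
      have : 1 ≤ E ^ 2 := by nlinarith
      linarith [mul_le_mul_of_nonneg_right this (sq_nonneg (y - a₂))]
    have h4 : E ≤ 1 + (1 + E ^ 2) / 4 := by nlinarith [sq_nonneg (E - 2)]
    linarith [mul_le_mul_of_nonneg_left h4 hD0]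

namespace Market

variable {d : ℕ} {M₁ M₂ : Market d} (π : Policy d)

/-- The laws of the first `t` observations in two Gaussian markets have a likelihood ratio, and
their Hellinger affinity is controlled by the deviations of the fees from `a₀`, if near `a₀` the
mean quantities of the two markets differ by little. -/
theorem exists_logLikelihoodRatio (hα₀ : M₂.α₀ = M₁.α₀) (hα₁ : M₂.α₁ = M₁.α₁)
    (hX : M₂.featureLaw = M₁.featureLaw)
    (hS₁ : M₁.supplyNoise = Measure.dirac 0) (hS₂ : M₂.supplyNoise = Measure.dirac 0)
    {v : ℝ≥0} (hv : v ≠ 0)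
    (hD₁ : M₁.demandNoise = gaussianReal 0 (v * ((M₁.α₁ - M₁.β) ^ 2).toNNReal))
    (hD₂ : M₂.demandNoise = gaussianReal 0 (v * ((M₂.α₁ - M₂.β) ^ 2).toNNReal))
    {C a₀ : ℝ} (hC : 0 ≤ C)
    (hmean : ∀ x a, (M₁.meanQuantity x a - M₂.meanQuantity x a) ^ 2 / (8 * v) ≤ C * (a - a₀) ^ 2)
    (t : ℕ) :
    ∃ ℓ : π.Seed × (Fin t → Obs d) → ℝ, Measurable ℓ ∧
      (∀ F : π.Seed × (Fin t → Obs d) → ENNReal, Measurable F →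
        ∫⁻ p, F p ∂M₂.histLaw π t
          = ∫⁻ p, ENNReal.ofReal (Real.exp (ℓ p)) * F p ∂M₁.histLaw π t) ∧
      1 ≤ ∫⁻ p, ENNReal.ofReal (Real.exp (ℓ p / 2)) ∂M₁.histLaw π t
        + ENNReal.ofReal (C / 2) *
          ∑ s ∈ Finset.range t, (M₁.sqDev π s a₀ + M₂.sqDev π s a₀) := by
  induction t with
  | zero =>
    refine ⟨fun _ => 0, measurable_const, fun F hF => ?_, ?_⟩
    · simp [M₂.histLaw_zero π M₁]
    · simp
  | succ t ih =>
    obtain ⟨ℓ, hℓ, hchange, haff⟩ := ih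
    let r : (Fin d → ℝ) → ℝ → ℝ → ℝ := fun x a q =>
      gaussianLogRatio (M₁.meanQuantity x a) (M₂.meanQuantity x a) v q
    let fee : π.Seed × (Fin t → Obs d) → (Fin d → ℝ) → ℝ := fun p x => π.fee t p.1 p.2 x M₁.α₀
    -- The log-likelihood ratio is additive over rounds; the fee of the last round is recomputed
    -- from the earlier observations and the recorded feature.
    let ℓ' : π.Seed × (Fin (t + 1) → Obs d) → ℝ := fun p =>
      ℓ (p.1, Fin.init p.2) + r (p.2 (Fin.last t)).2.1
        (fee (p.1, Fin.init p.2) (p.2 (Fin.last t)).2.1) (p.2 (Fin.last t)).2.2.2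
    have hℓ' : Measurable ℓ' := by
      have hi : Measurable (fun p : π.Seed × (Fin (t + 1) → Obs d) =>
          (p.1, (Fin.init p.2 : Fin t → Obs d))) :=
        measurable_fst.prodMk (measurable_pi_iff.2 fun i =>
          (measurable_pi_apply i.castSucc).comp measurable_snd)
      have hl : Measurable (fun p : π.Seed × (Fin (t + 1) → Obs d) => p.2 (Fin.last t)) :=
        (measurable_pi_apply _).comp measurable_snd
      have ha := measurable_fee_comp π t hi.fst hi.snd hl.snd.fst (measurable_const (a := M₁.α₀))
      exact (hℓ.comp hi).add (measurable_gaussianLogRatio v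
        (measurable_meanQuantity_comp hl.snd.fst ha) (measurable_meanQuantity_comp hl.snd.fst ha)
        hl.snd.snd.snd)
    have hval : ∀ p x q, ℓ' (appendRound M₁.α₀ M₁.α₁ π t p x q) = ℓ p + r x (fee p x) q := by
      intro p x q
      simp only [ℓ', appendRound, Fin.init_snoc, Fin.snoc_last]
    refine ⟨ℓ', hℓ', fun F hF => ?_, ?_⟩
    · have hm := measurable_lintegral_appendRound π hD₂ t hF
      rw [lintegral_histLaw_succ π hS₂ hD₂ t hF, hchange _ hm,
        lintegral_histLaw_succ π hS₁ hD₁ t (by fun_prop), hα₀, hα₁, hX]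
      refine lintegral_congr fun p => ?_
      rw [← lintegral_const_mul' _ _ ENNReal.ofReal_ne_top]
      refine lintegral_congr fun x => ?_
      have hFp : Measurable fun q => F (appendRound M₁.α₀ M₁.α₁ π t p x q) :=
        hF.comp (measurable_appendRound_comp π _ _ t measurable_const measurable_const
          measurable_id)
      rw [lintegral_gaussianReal_shift (M₁.meanQuantity x (fee p x)) _ hv hFp,
        ← lintegral_const_mul' _ _ ENNReal.ofReal_ne_top]
      refine lintegral_congr fun q => ?_
      rw [hval, ← mul_assoc, ← ENNReal.ofReal_mul (Real.exp_nonneg _), ← Real.exp_add]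
    · have hhalf : ∫⁻ p, ENNReal.ofReal (Real.exp (ℓ' p / 2)) ∂M₁.histLaw π (t + 1)
          = ∫⁻ p, ∫⁻ x, ENNReal.ofReal (Real.exp (ℓ p / 2) *
              Real.exp (-((M₁.meanQuantity x (fee p x) - M₂.meanQuantity x (fee p x)) ^ 2
                / (8 * v)))) ∂M₁.featureLaw ∂M₁.histLaw π t := by
        rw [lintegral_histLaw_succ π hS₁ hD₁ t (by fun_prop)]
        refine lintegral_congr fun p => lintegral_congr fun x => ?_
        rw [ENNReal.ofReal_mul (Real.exp_nonneg _), ← lintegral_exp_half_gaussianLogRatio _ _ hv,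
          ← lintegral_const_mul' _ _ ENNReal.ofReal_ne_top]
        refine lintegral_congr fun q => ?_
        rw [hval, add_div, Real.exp_add, ENNReal.ofReal_mul (Real.exp_nonneg _)]
      have hsqm : Measurable fun z : (π.Seed × (Fin t → Obs d)) × (Fin d → ℝ) =>
          ENNReal.ofReal ((fee z.1 z.2 - a₀) ^ 2) :=
        (((M₁.measurable_fee_prod π t).sub_const a₀).pow_const 2).ennreal_ofReal
      have hdev₂ : M₂.sqDev π t a₀ = ∫⁻ p, ∫⁻ x, ENNReal.ofReal (Real.exp (ℓ p)) *
          ENNReal.ofReal ((fee p x - a₀) ^ 2) ∂M₁.featureLaw ∂M₁.histLaw π t := by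
        unfold sqDev
        rw [hα₀, hX, hchange _ hsqm.lintegral_prod_right']
        exact lintegral_congr fun p => (lintegral_const_mul' _ _ ENNReal.ofReal_ne_top).symm
      have hstep : ∫⁻ p, ENNReal.ofReal (Real.exp (ℓ p / 2)) ∂M₁.histLaw π t ≤
          ∫⁻ p, ENNReal.ofReal (Real.exp (ℓ' p / 2)) ∂M₁.histLaw π (t + 1)
          + ENNReal.ofReal (C / 2) * (M₁.sqDev π t a₀ + M₂.sqDev π t a₀) := by
        have hAm : Measurable fun z : (π.Seed × (Fin t → Obs d)) × (Fin d → ℝ) =>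
            ENNReal.ofReal (Real.exp (ℓ z.1 / 2) * Real.exp (-((M₁.meanQuantity z.2 (fee z.1 z.2)
              - M₂.meanQuantity z.2 (fee z.1 z.2)) ^ 2 / (8 * v)))) := by
          have h1 := M₁.measurable_fee_prod π t
          have h2 := measurable_meanQuantity_comp (M := M₁) measurable_snd h1
          have h3 := measurable_meanQuantity_comp (M := M₂) measurable_snd h1
          have h4 : Measurable fun z : (π.Seed × (Fin t → Obs d)) × (Fin d → ℝ) => ℓ z.1 :=
            hℓ.comp measurable_fst
          exact ((h4.div_const 2).exp.mul
            (((h2.sub h3).pow_const 2).div_const (8 * (v : ℝ))).neg.exp).ennreal_ofReal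
        have hsqm₂ : Measurable fun z : (π.Seed × (Fin t → Obs d)) × (Fin d → ℝ) =>
            ENNReal.ofReal (Real.exp (ℓ z.1)) * ENNReal.ofReal ((fee z.1 z.2 - a₀) ^ 2) :=
          (by fun_prop : Measurable fun z : (π.Seed × (Fin t → Obs d)) × (Fin d → ℝ) =>
            ENNReal.ofReal (Real.exp (ℓ z.1))).mul hsqm
        have e1 : ∫⁻ p, ENNReal.ofReal (Real.exp (ℓ p / 2)) ∂M₁.histLaw π t
            = ∫⁻ z, ENNReal.ofReal (Real.exp (ℓ z.1 / 2))
                ∂(M₁.histLaw π t).prod M₁.featureLaw := by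
          rw [lintegral_prod _ (by fun_prop)]
          simp
        have e2 : M₁.sqDev π t a₀ = ∫⁻ z, ENNReal.ofReal ((fee z.1 z.2 - a₀) ^ 2)
                ∂(M₁.histLaw π t).prod M₁.featureLaw := by
          rw [lintegral_prod _ hsqm.aemeasurable]; rfl
        rw [e1, hhalf, hdev₂, e2,
          ← lintegral_prod (fun z : (π.Seed × (Fin t → Obs d)) × (Fin d → ℝ) =>
            ENNReal.ofReal (Real.exp (ℓ z.1)) * ENNReal.ofReal ((fee z.1 z.2 - a₀) ^ 2))
            hsqm₂.aemeasurable,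
          ← lintegral_prod (fun z : (π.Seed × (Fin t → Obs d)) × (Fin d → ℝ) =>
            ENNReal.ofReal (Real.exp (ℓ z.1 / 2) * Real.exp (-((M₁.meanQuantity z.2 (fee z.1 z.2)
              - M₂.meanQuantity z.2 (fee z.1 z.2)) ^ 2 / (8 * v))))) hAm.aemeasurable,
          ← lintegral_add_left hsqm, ← lintegral_const_mul' _ _ ENNReal.ofReal_ne_top,
          ← lintegral_add_left hAm]
        refine lintegral_mono_fn' le_rfl fun z => ?_
        have h := exp_half_le_add (l := ℓ z.1) (hmean z.2 (fee z.1 z.2)) (by positivity)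
        have hE := Real.exp_pos (ℓ z.1)
        calc ENNReal.ofReal (Real.exp (ℓ z.1 / 2)) ≤ _ := ENNReal.ofReal_le_ofReal h
          _ = _ := by
            rw [ENNReal.ofReal_add (by positivity) (by positivity),
              ENNReal.ofReal_mul_add_mul (by positivity) (by positivity) hE.le]
      rw [Finset.sum_range_succ, mul_add]
      calc (1 : ENNReal) ≤ _ := haff
        _ ≤ _ := add_le_add_left hstep _
        _ = _ := by ring

/-- In every round, the deviations from the optimal fees of two statistically close markets
cannot both be small. -/
theorem affinity_le_sqDev (hα₀ : M₂.α₀ = M₁.α₀) (hX : M₂.featureLaw = M₁.featureLaw) (t : ℕ)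
    {ℓ : π.Seed × (Fin t → Obs d) → ℝ} (hℓ : Measurable ℓ)
    (hchange : ∀ F : π.Seed × (Fin t → Obs d) → ENNReal, Measurable F →
        ∫⁻ p, F p ∂M₂.histLaw π t
          = ∫⁻ p, ENNReal.ofReal (Real.exp (ℓ p)) * F p ∂M₁.histLaw π t) (a₁ a₂ : ℝ) :
    ENNReal.ofReal ((a₁ - a₂) ^ 2 / 2) *
        ∫⁻ p, ENNReal.ofReal (Real.exp (ℓ p / 2)) ∂M₁.histLaw π t
      ≤ M₁.sqDev π t a₁ + M₂.sqDev π t a₂ + ENNReal.ofReal ((a₁ - a₂) ^ 2 / 4) := by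
  set fee : π.Seed × (Fin t → Obs d) → (Fin d → ℝ) → ℝ := fun p x => π.fee t p.1 p.2 x M₁.α₀
  have hsqm : ∀ a, Measurable fun z : (π.Seed × (Fin t → Obs d)) × (Fin d → ℝ) =>
      ENNReal.ofReal ((fee z.1 z.2 - a) ^ 2) := fun a =>
    (((M₁.measurable_fee_prod π t).sub_const a).pow_const 2).ennreal_ofReal
  have hone : ∫⁻ p, ENNReal.ofReal (Real.exp (ℓ p)) ∂M₁.histLaw π t = 1 := by
    have := hchange (fun _ => 1) measurable_const
    simpa using this.symm
  have hdev₂ : M₂.sqDev π t a₂ = ∫⁻ p, ENNReal.ofReal (Real.exp (ℓ p)) *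
      ∫⁻ x, ENNReal.ofReal ((fee p x - a₂) ^ 2) ∂M₁.featureLaw ∂M₁.histLaw π t := by
    unfold sqDev
    rw [hα₀, hX, hchange _ (hsqm a₂).lintegral_prod_right']
  -- The likelihood ratio integrates to 1, so `1 + exp ℓ` has integral 2.
  have hquarter : ENNReal.ofReal ((a₁ - a₂) ^ 2 / 4)
      = ∫⁻ p, ENNReal.ofReal ((a₁ - a₂) ^ 2 / 8 * (1 + Real.exp (ℓ p))) ∂M₁.histLaw π t := by
    have h : ∀ p, ENNReal.ofReal ((a₁ - a₂) ^ 2 / 8 * (1 + Real.exp (ℓ p)))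
        = ENNReal.ofReal ((a₁ - a₂) ^ 2 / 8) * (1 + ENNReal.ofReal (Real.exp (ℓ p))) := by
      intro p
      rw [ENNReal.ofReal_mul (by positivity), ENNReal.ofReal_add zero_le_one (Real.exp_nonneg _),
        ENNReal.ofReal_one]
    simp only [h]
    rw [lintegral_const_mul' _ _ ENNReal.ofReal_ne_top, lintegral_add_left measurable_const, hone]
    simp only [lintegral_one, measure_univ]
    rw [one_add_one_eq_two, ← ENNReal.ofReal_ofNat 2, ← ENNReal.ofReal_mul (by positivity)]
    congr 1
    ring
  have hp : ∀ p, ENNReal.ofReal ((a₁ - a₂) ^ 2 / 2) * ENNReal.ofReal (Real.exp (ℓ p / 2)) ≤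
      ∫⁻ x, ENNReal.ofReal ((fee p x - a₁) ^ 2) ∂M₁.featureLaw
        + ENNReal.ofReal (Real.exp (ℓ p)) *
          ∫⁻ x, ENNReal.ofReal ((fee p x - a₂) ^ 2) ∂M₁.featureLaw
        + ENNReal.ofReal ((a₁ - a₂) ^ 2 / 8 * (1 + Real.exp (ℓ p))) := by
    intro p
    have hpt : ∀ x, ENNReal.ofReal ((a₁ - a₂) ^ 2 / 2) * ENNReal.ofReal (Real.exp (ℓ p / 2))
        ≤ ENNReal.ofReal ((fee p x - a₁) ^ 2)
          + (ENNReal.ofReal (Real.exp (ℓ p)) * ENNReal.ofReal ((fee p x - a₂) ^ 2)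
          + ENNReal.ofReal ((a₁ - a₂) ^ 2 / 8 * (1 + Real.exp (ℓ p)))) := by
      intro x
      have hE := Real.exp_pos (ℓ p / 2)
      have h2 : Real.exp (ℓ p) = Real.exp (ℓ p / 2) ^ 2 := by
        rw [← Real.exp_nat_mul]; congr 1; push_cast; ring
      rw [h2, ← ENNReal.ofReal_mul (by positivity), ← ENNReal.ofReal_mul (by positivity),
        ← ENNReal.ofReal_add (by positivity) (by positivity),
        ← ENNReal.ofReal_add (by positivity) (by positivity)]
      exact ENNReal.ofReal_le_ofReal (half_sq_mul_le a₁ a₂ (fee p x) hE)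
    have hx : ∀ a, Measurable fun x => ENNReal.ofReal ((fee p x - a) ^ 2) := fun a =>
      (((measurable_fee_comp π t measurable_const measurable_const measurable_id
        measurable_const).sub_const a).pow_const 2).ennreal_ofReal
    have := lintegral_mono_fn' (le_refl M₁.featureLaw) hpt
    rw [lintegral_add_left (hx a₁), lintegral_add_left ((hx a₂).const_mul _),
      lintegral_const_mul _ (hx a₂)] at this
    simpa [add_assoc] using this
  rw [hdev₂, hquarter, sqDev, ← lintegral_const_mul' _ _ ENNReal.ofReal_ne_top,
    ← lintegral_add_left (hsqm a₁).lintegral_prod_right', ← lintegral_add_right _ (by fun_prop)]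
  exact lintegral_mono_fn' le_rfl hp

/-- Moving the reference point of the deviations. -/
theorem sqDev_le (M : Market d) (t : ℕ) (a₁ a₂ : ℝ) :
    M.sqDev π t a₁ ≤ 2 * M.sqDev π t a₂ + ENNReal.ofReal (2 * (a₁ - a₂) ^ 2) := by
  have hsqm : ∀ a, Measurable fun z : (π.Seed × (Fin t → Obs d)) × (Fin d → ℝ) =>
      ENNReal.ofReal ((π.fee t z.1.1 z.1.2 z.2 M.α₀ - a) ^ 2) := fun a =>
    (((M.measurable_fee_prod π t).sub_const a).pow_const 2).ennreal_ofReal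
  have e : ∀ a, M.sqDev π t a = ∫⁻ z, ENNReal.ofReal ((π.fee t z.1.1 z.1.2 z.2 M.α₀ - a) ^ 2)
      ∂(M.histLaw π t).prod M.featureLaw := fun a => by
    rw [lintegral_prod _ (hsqm a).aemeasurable]; rfl
  have e2 : ENNReal.ofReal (2 * (a₁ - a₂) ^ 2) = ∫⁻ _, ENNReal.ofReal (2 * (a₁ - a₂) ^ 2)
      ∂(M.histLaw π t).prod M.featureLaw := by simp
  rw [e, e, e2, ← lintegral_const_mul' _ _ ENNReal.ofNat_ne_top,
    ← lintegral_add_left ((hsqm a₂).const_mul 2)]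
  refine lintegral_mono_fn' le_rfl fun z => ?_
  rw [← ENNReal.ofReal_ofNat 2, ← ENNReal.ofReal_mul (by positivity),
    ← ENNReal.ofReal_add (by positivity) (by positivity)]
  refine ENNReal.ofReal_le_ofReal ?_
  nlinarith [sq_nonneg (π.fee t z.1.1 z.1.2 z.2 M.α₀ - a₂ + (a₁ - a₂))]

end Market

end ServiceFee

/-! ### The two-point lower bound. -/

namespace ServiceFee

open scoped NNReal

namespace Market

variable {d : ℕ} {M₁ M₂ : Market d} (π : Policy d)

/-- If the total deviation were at most `R`, `hclose` would keep the affinity at least `3/4`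
throughout, forcing a deviation of `(a₁ - a₂)² / 8` in every round, against `hsep`. -/
theorem lt_sum_sqDev (hα₀ : M₂.α₀ = M₁.α₀) (hα₁ : M₂.α₁ = M₁.α₁)
    (hX : M₂.featureLaw = M₁.featureLaw)
    (hS₁ : M₁.supplyNoise = Measure.dirac 0) (hS₂ : M₂.supplyNoise = Measure.dirac 0)
    {v : ℝ≥0} (hv : v ≠ 0)
    (hD₁ : M₁.demandNoise = gaussianReal 0 (v * ((M₁.α₁ - M₁.β) ^ 2).toNNReal))
    (hD₂ : M₂.demandNoise = gaussianReal 0 (v * ((M₂.α₁ - M₂.β) ^ 2).toNNReal))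
    {C a₁ a₂ R : ℝ} {T : ℕ} (hC : 0 ≤ C)
    (hmean : ∀ x a, (M₁.meanQuantity x a - M₂.meanQuantity x a) ^ 2 / (8 * v) ≤ C * (a - a₁) ^ 2)
    (hR : 0 ≤ R) (hclose : C * (R + T * (a₁ - a₂) ^ 2) ≤ 1 / 4)
    (hsep : R < T * ((a₁ - a₂) ^ 2 / 8)) :
    ENNReal.ofReal R < ∑ t ∈ Finset.range T, M₁.sqDev π t a₁
      + ∑ t ∈ Finset.range T, M₂.sqDev π t a₂ := by
  by_contra! hle
  have hround : ∀ t ∈ Finset.range T,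
      ENNReal.ofReal ((a₁ - a₂) ^ 2 / 8) ≤ M₁.sqDev π t a₁ + M₂.sqDev π t a₂ := by
    intro t ht
    obtain ⟨ℓ, hℓ, hchange, haff⟩ := exists_logLikelihoodRatio π hα₀ hα₁ hX hS₁ hS₂ hv hD₁ hD₂
      hC hmean t
    -- The affinity bound measures both deviations from `a₁`, while `R` controls that of `M₂` from
    -- `a₂`; recentring costs `2 (a₁ - a₂)²` per round.
    have hsum : ∑ s ∈ Finset.range t, (M₁.sqDev π s a₁ + M₂.sqDev π s a₁)
        ≤ ENNReal.ofReal (2 * (R + T * (a₁ - a₂) ^ 2)) := by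
      calc ∑ s ∈ Finset.range t, (M₁.sqDev π s a₁ + M₂.sqDev π s a₁)
          ≤ ∑ s ∈ Finset.range T, (M₁.sqDev π s a₁ + M₂.sqDev π s a₁) :=
            Finset.sum_le_sum_of_subset (Finset.range_mono (Finset.mem_range.1 ht).le)
        _ ≤ ∑ s ∈ Finset.range T, (2 * (M₁.sqDev π s a₁ + M₂.sqDev π s a₂)
              + ENNReal.ofReal (2 * (a₁ - a₂) ^ 2)) := by
            refine Finset.sum_le_sum fun s _ => ?_
            have h1 := sqDev_le π M₂ s a₁ a₂
            have h2 : M₁.sqDev π s a₁ ≤ 2 * M₁.sqDev π s a₁ := by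
              rw [two_mul]; exact le_self_add
            calc _ ≤ _ := add_le_add h2 h1
              _ = _ := by ring
        _ = 2 * (∑ s ∈ Finset.range T, M₁.sqDev π s a₁ + ∑ s ∈ Finset.range T, M₂.sqDev π s a₂)
              + T * ENNReal.ofReal (2 * (a₁ - a₂) ^ 2) := by
            rw [Finset.sum_add_distrib, ← Finset.mul_sum, Finset.sum_add_distrib]
            simp
        _ ≤ 2 * ENNReal.ofReal R + T * ENNReal.ofReal (2 * (a₁ - a₂) ^ 2) := by gcongr
        _ = ENNReal.ofReal (2 * (R + T * (a₁ - a₂) ^ 2)) := by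
            rw [← ENNReal.ofReal_ofNat 2, ← ENNReal.ofReal_natCast,
              ← ENNReal.ofReal_mul (by positivity), ← ENNReal.ofReal_mul (by positivity),
              ← ENNReal.ofReal_add (by positivity) (by positivity)]
            congr 1
            ring
    have hρ : ENNReal.ofReal (3 / 4)
        ≤ ∫⁻ p, ENNReal.ofReal (Real.exp (ℓ p / 2)) ∂M₁.histLaw π t := by
      have h1 : ENNReal.ofReal (3 / 4) + ENNReal.ofReal (1 / 4) ≤
          ∫⁻ p, ENNReal.ofReal (Real.exp (ℓ p / 2)) ∂M₁.histLaw π t + ENNReal.ofReal (1 / 4) := by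
        calc ENNReal.ofReal (3 / 4) + ENNReal.ofReal (1 / 4) = 1 := by
              rw [← ENNReal.ofReal_add (by norm_num) (by norm_num)]; norm_num
          _ ≤ _ := haff
          _ ≤ _ := by
              gcongr
              refine (mul_le_mul_right hsum _).trans ?_
              rw [← ENNReal.ofReal_mul (by positivity)]
              refine ENNReal.ofReal_le_ofReal ?_
              linarith
      exact (ENNReal.add_le_add_iff_right ENNReal.ofReal_ne_top).1 h1
    have h2 := affinity_le_sqDev π hα₀ hX t hℓ hchange a₁ a₂
    refine (ENNReal.add_le_add_iff_right (a := ENNReal.ofReal ((a₁ - a₂) ^ 2 / 4))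
      ENNReal.ofReal_ne_top).1 (le_trans ?_ h2)
    -- The constants match since `1/8 + 1/4 = 1/2 * 3/4`.
    refine le_trans (le_of_eq ?_) (mul_le_mul_right hρ _)
    rw [← ENNReal.ofReal_mul (by positivity), ← ENNReal.ofReal_add (by positivity) (by positivity)]
    congr 1
    ring
  have h3 := Finset.sum_le_sum hround
  rw [Finset.sum_add_distrib, Finset.sum_const, Finset.card_range, nsmul_eq_mul] at h3
  have h4 := h3.trans hle
  rw [← ENNReal.ofReal_natCast, ← ENNReal.ofReal_mul (by positivity),
    ENNReal.ofReal_le_ofReal_iff hR] at h4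
  linarith

theorem sum_sqDev_le_of_regret_lt {M : Market d} (hS : M.supplyNoise = Measure.dirac 0) {r : ℝ}
    (hf : M.f = fun _ => r) (hr : M.α₀ ≤ r) {T : ℕ} {y : ℝ} (hy : 0 ≤ y)
    (h : M.regret π (truthful d) T < (y : EReal)) :
    ∑ t ∈ Finset.range T, M.sqDev π t ((r - M.α₀) / 2) ≤ ENNReal.ofReal ((M.α₁ - M.β) * y) := by
  have hm := M.slope_pos
  have h1 := (sum_sqDev_le_regret π hS hf hr T).trans h.le
  rw [← max_eq_left hy, ← EReal.coe_ennreal_ofReal, EReal.coe_ennreal_le_coe_ennreal_iff] at h1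
  calc ∑ t ∈ Finset.range T, M.sqDev π t ((r - M.α₀) / 2)
      = ENNReal.ofReal (M.α₁ - M.β) * (ENNReal.ofReal (M.α₁ - M.β)⁻¹ *
        ∑ t ∈ Finset.range T, M.sqDev π t ((r - M.α₀) / 2)) := by
        rw [← mul_assoc, ← ENNReal.ofReal_mul hm.le, mul_inv_cancel₀ hm.ne', ENNReal.ofReal_one,
          one_mul]
    _ ≤ ENNReal.ofReal (M.α₁ - M.β) * ENNReal.ofReal y := mul_le_mul_right h1 _
    _ = _ := (ENNReal.ofReal_mul hm.le).symm

/-- If `M₂` is `M₁` with slope and excess demand perturbed by a relative amount of order `T ^ (-1/4)`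
in such a way that the optimal fee of `M₁` is uninformative, then the regret is of order `√T` in
one of the two markets. -/
theorem le_regret_or_le_regret (hα₀ : M₂.α₀ = M₁.α₀) (hα₁ : M₂.α₁ = M₁.α₁)
    (hX : M₂.featureLaw = M₁.featureLaw)
    (hS₁ : M₁.supplyNoise = Measure.dirac 0) (hS₂ : M₂.supplyNoise = Measure.dirac 0)
    {v : ℝ≥0} (hv : v ≠ 0)
    (hD₁ : M₁.demandNoise = gaussianReal 0 (v * ((M₁.α₁ - M₁.β) ^ 2).toNNReal))
    (hD₂ : M₂.demandNoise = gaussianReal 0 (v * ((M₂.α₁ - M₂.β) ^ 2).toNNReal))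
    {T : ℕ} (hT : 1 ≤ T) {a m V η c : ℝ} (ha : 0 < a) (hV : 0 < V) (hη : 0 < η) (hη1 : η ≤ 1)
    (hc : 0 < c) (hm₁ : M₁.α₁ - M₁.β = m) (hvV : v * m ^ 2 = V)
    (hm₂ : M₂.α₁ - M₂.β = m * (1 + η / Real.sqrt (Real.sqrt T)))
    (hf₁ : M₁.f = fun _ => M₁.α₀ + 2 * a)
    (hf₂ : M₂.f = fun _ => M₁.α₀ + 2 * a + a * (η / Real.sqrt (Real.sqrt T)))
    (hηaV : a ^ 2 * η ≤ 4 * V) (hcV : 3 * m * c ≤ V) (hcη : 3 * m * c < a ^ 2 * η ^ 2 / 32) :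
    ((c * Real.sqrt T : ℝ) : EReal) ≤ M₁.regret π (truthful d) T ∨
      ((c * Real.sqrt T : ℝ) : EReal) ≤ M₂.regret π (truthful d) T := by
  have hm : 0 < m := hm₁ ▸ M₁.slope_pos
  have hT1 : (1 : ℝ) ≤ T := by exact_mod_cast hT
  have hS1 : 1 ≤ Real.sqrt T := Real.one_le_sqrt.2 hT1
  have hSS : Real.sqrt T ^ 2 = T := Real.sq_sqrt (by linarith)
  generalize Real.sqrt T = S at *
  have hsS : 1 ≤ Real.sqrt S := Real.one_le_sqrt.2 hS1
  have hθ : 0 < η / Real.sqrt S := by positivity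
  have hθη : η / Real.sqrt S ≤ η := div_le_self hη.le hsS
  have hθS : (η / Real.sqrt S) ^ 2 * S = η ^ 2 := by
    rw [div_pow, Real.sq_sqrt (by linarith)]; field_simp
  generalize η / Real.sqrt S = θ at *
  have hTθ : (T : ℝ) * θ ^ 2 = S * η ^ 2 := by rw [← hSS, ← hθS]; ring
  have haθ : 0 < a * θ := mul_pos ha hθ
  by_contra! h
  have hcS : 0 ≤ c * S := by positivity
  have hA₁ := sum_sqDev_le_of_regret_lt π hS₁ hf₁ (by linarith) hcS h.1
  have hA₂ := sum_sqDev_le_of_regret_lt π hS₂ hf₂ (by linarith) hcS h.2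
  rw [show (M₁.α₀ + 2 * a - M₁.α₀) / 2 = a by ring, hm₁] at hA₁
  rw [show (M₁.α₀ + 2 * a + a * θ - M₂.α₀) / 2 = a + a * θ / 2 by rw [hα₀]; ring, hm₂] at hA₂
  have hdiff : a - (a + a * θ / 2) = -(a * θ / 2) := by ring
  -- The slopes add up to `m (2 + θ) ≤ 3m`, whence `R`. The constant `C` comes from `v m² = V` after
  -- dropping a factor `(1 + θ)⁻² ≤ 1`.
  have hlt := lt_sum_sqDev π hα₀ hα₁ hX hS₁ hS₂ hv hD₁ hD₂
    (C := θ ^ 2 / (8 * V)) (a₁ := a) (a₂ := a + a * θ / 2)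
    (R := 3 * m * c * S) (T := T) (by positivity) ?_ (by positivity) ?_ ?_
  · refine absurd (add_le_add hA₁ hA₂) (not_le.2 (lt_of_le_of_lt ?_ hlt))
    rw [← ENNReal.ofReal_add (by positivity) (by positivity)]
    refine ENNReal.ofReal_le_ofReal ?_
    have : θ * (m * (c * S)) ≤ 1 * (m * (c * S)) := by gcongr; linarith
    linarith
  · intro x y
    simp only [meanQuantity, hf₁, hf₂, hm₁, hm₂, hα₀]
    -- The difference of the means vanishes at `y = a`: this is what the coupled perturbation of
    -- slope and intercept is designed for.
    have h1 : (M₁.α₀ + 2 * a - M₁.α₀ - y) / m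
        - (M₁.α₀ + 2 * a + a * θ - M₁.α₀ - y) / (m * (1 + θ))
        = -(θ * (y - a) / (m * (1 + θ))) := by
      field_simp
      ring
    have h2 : (-(θ * (y - a) / (m * (1 + θ)))) ^ 2 / (8 * v)
        = θ ^ 2 / (8 * V) * (y - a) ^ 2 / (1 + θ) ^ 2 := by
      have : (v : ℝ) ≠ 0 := by exact_mod_cast hv
      rw [← hvV]
      field_simp
    rw [h1, h2]
    exact div_le_self (by positivity) (one_le_pow₀ (by linarith))
  · rw [hdiff]
    -- Both terms are of order `θ² S = η²`, so the information is bounded independently of `T`.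
    have h1 : θ ^ 2 / (8 * V) * (3 * m * c * S + T * (-(a * θ / 2)) ^ 2)
        = (3 * m * c * η ^ 2 + η ^ 4 * a ^ 2 / 4) / (8 * V) := by
      have : T * (-(a * θ / 2)) ^ 2 = a ^ 2 / 4 * (S * η ^ 2) := by rw [← hTθ]; ring
      rw [this, show η ^ 4 = η ^ 2 * η ^ 2 by ring, ← hθS]
      field_simp
    rw [h1, div_le_iff₀ (by positivity)]
    have h2 : η ^ 2 ≤ 1 := pow_le_one₀ hη.le hη1
    have h3 : η ^ 4 ≤ η := by
      calc η ^ 4 ≤ η ^ 1 := pow_le_pow_of_le_one hη.le hη1 (by norm_num)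
        _ = η := pow_one η
    have h4 : 3 * m * c * η ^ 2 ≤ V * 1 := by gcongr
    have h5 : η ^ 4 * a ^ 2 ≤ η * a ^ 2 := by gcongr
    linarith
  · rw [hdiff]
    have : (T : ℝ) * ((-(a * θ / 2)) ^ 2 / 8) = a ^ 2 * η ^ 2 / 32 * S := by
      rw [show (T : ℝ) * ((-(a * θ / 2)) ^ 2 / 8) = a ^ 2 / 32 * (T * θ ^ 2) by ring, hTθ]; ring
    rw [this]
    gcongr

end Market

/-! ### The hard instances and the final choice of constants. -/

/-- The market without supply noise, with constant demand intercept `r` and demand noise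
`N(0, v)`. -/
noncomputable def gaussianMarket {d : ℕ} (α₀ r : ℝ) {α₁ β : ℝ} (hα₁ : 0 ≤ α₁) (hβ : β < 0)
    (PX : Measure (Fin d → ℝ)) [IsProbabilityMeasure PX]
    (hPX : ∀ᵐ x ∂PX, x ∈ Set.Icc (0 : Fin d → ℝ) 1) {v : ℝ≥0} (hv : v ≠ 0) : Market d where
  α₀ := α₀
  α₁ := α₁
  β := β
  f := fun _ => r
  featureLaw := PX
  supplyNoise := Measure.dirac 0
  demandNoise := gaussianReal 0 v
  α₁_nonneg := hα₁
  β_neg := hβ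
  measurable_f := measurable_const
  isProb_feature := inferInstance
  isProb_supply := inferInstance
  isProb_demand := inferInstance
  feature_mem := hPX
  supply_mean := by simp
  supply_subGaussian := ⟨0, ⟨fun t => integrable_dirac (by simp), fun t => by simp [mgf]⟩⟩
  demand_memLp := memLp_id_gaussianReal 2
  demand_mean := integral_id_gaussianReal
  demand_logConcave := stronglyLogConcave_gaussianReal hv

end ServiceFee

theorem theorem3
    (α₀ α₁ B βlo βhi vlo vhi : ℝ)
    (hα₁ : 0 ≤ α₁) (hB : 0 < B) (hα₀ : α₀ < B)
    (hβ : βlo < βhi) (hβhi : βhi < 0) (hvlo : 0 ≤ vlo) (hv : vlo < vhi) :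
    ∃ c : ℝ, 0 < c ∧
      ∀ (d : ℕ) (F : Set ((Fin d → ℝ) → ℝ)) (PX : MeasureTheory.Measure (Fin d → ℝ)),
        (∀ r : ℝ, |r| ≤ B → (fun _ => r) ∈ F) →
        MeasureTheory.IsProbabilityMeasure PX →
        (∀ᵐ x ∂PX, x ∈ Set.Icc (0 : Fin d → ℝ) 1) →
        ∀ (T : ℕ), 1 ≤ T → ∀ π : ServiceFee.Policy d,
          ∃ M : ServiceFee.Market d,
            M.α₀ = α₀ ∧ M.α₁ = α₁ ∧ M.featureLaw = PX ∧
            ProbabilityTheory.variance (fun e : ℝ => e) M.supplyNoise = 0 ∧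
            M.f ∈ F ∧ (∀ x, |M.f x| ≤ B) ∧
            M.β ∈ Set.Icc βlo βhi ∧
            ProbabilityTheory.variance (fun e : ℝ => e) M.demandNoise ∈ Set.Icc vlo vhi ∧
            ∀ b : ServiceFee.Buyer d, M.IsMyopic b →
              ((c * Real.sqrt T : ℝ) : EReal) ≤ M.regret π b T := by
  -- The first market has `r` strictly above `α₀`, for a positive optimal fee, and strictly below
  -- `B`; slope and variance are midpoints. This leaves room for the perturbation.
  obtain ⟨r, hrα, hrlo, hrhi⟩ : ∃ r, α₀ < r ∧ -B ≤ r ∧ r < B := by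
    refine ⟨(max α₀ (-B) + B) / 2, ?_, ?_, ?_⟩
    · linarith [le_max_left α₀ (-B)]
    · linarith [le_max_right α₀ (-B)]
    · linarith [max_lt hα₀ (by linarith : -B < B)]
  obtain ⟨β, hβdef⟩ : ∃ β, β = (βlo + βhi) / 2 := ⟨_, rfl⟩
  obtain ⟨m, hmdef⟩ : ∃ m, m = α₁ - β := ⟨_, rfl⟩
  obtain ⟨V, hVdef⟩ : ∃ V, V = (vlo + vhi) / 2 := ⟨_, rfl⟩
  obtain ⟨a, hadef⟩ : ∃ a, a = (r - α₀) / 2 := ⟨_, rfl⟩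
  have hβneg : β < 0 := by linarith
  have hm : 0 < m := by linarith
  have hV : 0 < V := by linarith
  have ha : 0 < a := by linarith
  -- The middle three bounds keep intercept, slope and noise variance of the second market in their
  -- ranges; the last one keeps the histories close. Neither `η` nor `c` depends on `T` or `d`.
  obtain ⟨η, hη, hη1, hηa, hηm, hηV, hηaV⟩ : ∃ η : ℝ, 0 < η ∧ η ≤ 1 ∧ a * η ≤ B - r ∧
      m * η ≤ (βhi - βlo) / 2 ∧ 3 * V * η ≤ (vhi - vlo) / 2 ∧ a ^ 2 * η ≤ 4 * V := by
    refine ⟨min 1 (min ((B - r) / a) (min ((βhi - βlo) / 2 / m) (min ((vhi - vlo) / 2 / (3 * V))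
      (4 * V / a ^ 2)))), ?_, ?_⟩
    · have h1 : 0 < B - r := by linarith
      have h2 : 0 < βhi - βlo := by linarith
      have h3 : 0 < vhi - vlo := by linarith
      simp only [lt_min_iff]
      exact ⟨one_pos, by positivity, by positivity, by positivity, by positivity⟩
    · have h : ∀ x y z : ℝ, 0 < x → z ≤ y / x → x * z ≤ y := fun x y z hx hz => by
        rw [le_div_iff₀ hx] at hz; linarith
      refine ⟨min_le_left _ _, h _ _ _ ha ?_, h _ _ _ hm ?_, h _ _ _ (by positivity) ?_,
        h _ _ _ (by positivity) ?_⟩ <;> simp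
  obtain ⟨c, hc, hcV, hcη⟩ : ∃ c : ℝ, 0 < c ∧ 3 * m * c ≤ V ∧ 3 * m * c < a ^ 2 * η ^ 2 / 32 := by
    refine ⟨min (V / (3 * m)) (a ^ 2 * η ^ 2 / 64 / (3 * m)), by positivity, ?_, ?_⟩
    · have := min_le_left (V / (3 * m)) (a ^ 2 * η ^ 2 / 64 / (3 * m))
      rw [le_div_iff₀ (by positivity)] at this
      linarith
    · have := min_le_right (V / (3 * m)) (a ^ 2 * η ^ 2 / 64 / (3 * m))
      rw [le_div_iff₀ (by positivity)] at this
      have : 0 < a ^ 2 * η ^ 2 := by positivity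
      linarith
  refine ⟨c, hc, fun d F PX hF hPX hmem T hT π => ?_⟩
  have hT1 : (1 : ℝ) ≤ T := by exact_mod_cast hT
  have hsS : 1 ≤ Real.sqrt (Real.sqrt T) := Real.one_le_sqrt.2 (Real.one_le_sqrt.2 hT1)
  obtain ⟨θ, hθdef⟩ : ∃ θ, θ = η / Real.sqrt (Real.sqrt T) := ⟨_, rfl⟩
  have hθ : 0 < θ := by rw [hθdef]; positivity
  have hθη : θ ≤ η := hθdef ▸ div_le_self hη.le hsS
  have hmθ : 0 < m * θ := mul_pos hm hθ
  have haθ : 0 < a * θ := mul_pos ha hθ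
  have hmθη : m * θ ≤ m * η := by gcongr
  have haθη : a * θ ≤ a * η := by gcongr
  have hβ₂ : β - m * θ < 0 := by linarith
  have hm₂ : α₁ - (β - m * θ) = m * (1 + θ) := by rw [hmdef]; ring
  obtain ⟨v, hvV, hvne⟩ : ∃ v : NNReal, v * m ^ 2 = V ∧ v ≠ 0 := by
    refine ⟨(V / m ^ 2).toNNReal, ?_, (Real.toNNReal_pos.2 (by positivity)).ne'⟩
    rw [Real.coe_toNNReal _ (by positivity)]
    field_simp
  have hne : ∀ β' : ℝ, β' < 0 → v * ((α₁ - β') ^ 2).toNNReal ≠ 0 := by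
    intro β' h
    have : 0 < α₁ - β' := by linarith
    exact mul_ne_zero hvne (Real.toNNReal_pos.2 (pow_pos this 2)).ne'
  have hvar : ∀ β' : ℝ, ProbabilityTheory.variance (fun e : ℝ => e)
      (gaussianReal 0 (v * ((α₁ - β') ^ 2).toNNReal)) = v * (α₁ - β') ^ 2 := by
    intro β'
    rw [variance_fun_id_gaussianReal, NNReal.coe_mul, Real.coe_toNNReal _ (sq_nonneg _)]
  have hvar₁ : v * (α₁ - β) ^ 2 = V := by rw [← hmdef, hvV]
  have hvar₂ : v * (α₁ - (β - m * θ)) ^ 2 = V * (1 + θ) ^ 2 := by rw [hm₂, ← hvV]; ring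
  have habs₁ : |r| ≤ B := abs_le.2 ⟨hrlo, hrhi.le⟩
  have habs₂ : |r + a * θ| ≤ B := abs_le.2 ⟨by linarith, by linarith⟩
  have hsupp : ProbabilityTheory.variance (fun e : ℝ => e) (MeasureTheory.Measure.dirac 0) = 0 :=
    ProbabilityTheory.variance_dirac _
  have hr : α₀ + 2 * a = r := by rw [hadef]; ring
  rcases ServiceFee.Market.le_regret_or_le_regret π
    (M₁ := ServiceFee.gaussianMarket α₀ r hα₁ hβneg PX hmem (hne β hβneg))
    (M₂ := ServiceFee.gaussianMarket α₀ (r + a * θ) hα₁ hβ₂ PX hmem (hne _ hβ₂))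
    rfl rfl rfl rfl rfl hvne rfl rfl hT ha hV hη hη1 hc hmdef.symm hvV (hθdef ▸ hm₂)
    (funext fun _ => hr.symm) (funext fun _ => by rw [← hθdef]; exact congrArg (· + a * θ) hr.symm)
    hηaV hcV hcη with h | h
  · refine ⟨ServiceFee.gaussianMarket α₀ r hα₁ hβneg PX hmem (hne β hβneg),
      rfl, rfl, rfl, hsupp, hF r habs₁, fun _ => habs₁, ⟨?_, ?_⟩, ?_, fun b hb => ?_⟩
    rotate_left 3
    · rw [ServiceFee.Market.eq_truthful_of_isMyopic _ hb]; exact h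
    · change βlo ≤ β; linarith
    · change β ≤ βhi; linarith
    · refine (hvar β).symm ▸ hvar₁.symm ▸ ⟨?_, ?_⟩ <;> linarith
  · refine ⟨ServiceFee.gaussianMarket α₀ (r + a * θ) hα₁ hβ₂ PX hmem (hne _ hβ₂),
      rfl, rfl, rfl, hsupp, hF _ habs₂, fun _ => habs₂, ⟨?_, ?_⟩, ?_, fun b hb => ?_⟩
    rotate_left 3
    · rw [ServiceFee.Market.eq_truthful_of_isMyopic _ hb]; exact h
    · change βlo ≤ β - m * θ; linarith
    · change β - m * θ ≤ βhi; linarith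
    · have h1 : (1 + θ) ^ 2 ≤ 1 + 3 * η := by nlinarith
      have h2 : V * 1 ≤ V * (1 + θ) ^ 2 := by gcongr; exact one_le_pow₀ (by linarith)
      have h3 := mul_le_mul_of_nonneg_left h1 hV.le
      refine (hvar (β - m * θ)).symm ▸ hvar₂.symm ▸ ⟨?_, ?_⟩ <;> linarith
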